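/- **Theorem 1.1 (Existence).** Let $H^6_{per}([0,2\pi],\mathbb R)$ be the space of real $2\pi$-periodic functions with weak derivatives up to order six in $L^2([0,2\pi])$ (identified with their continuous representatives), with norm $\|u\|_{H^6}^2=\sum_{j\le 6}\int_0^{2\pi}|\partial_\xi^j u|^2\,d\xi$. Fix $s\in(-\sqrt{27/2},\sqrt{27/2})$. For $\varepsilon>0$ and $\omega\in[-\tfrac12,\tfrac12]$ put $k=\sqrt{1+2\omega\varepsilon}$ and consider, for a constant $q\in\mathbb R$, the equation $$-k^2\bigl[-(1+k^2\partial_\xi^2)^2u+\varepsilon^2u-su^2-u^3\bigr]=q .\qquad(1.5)$$ There exist $\varepsilon_0>0$, $\delta>0$ and $C$, depending only on $s$, such that for all $\varepsilon\in(0,\varepsilon_0)$ and all $\omega\in[-\tfrac12,\tfrac12]$: * if $|\omega|<\tfrac12$, there is exactly one $\tilde u=\tilde u_{\varepsilon,\omega,s}\in H^6_{per}([0,2\pi],\mathbb R)$ with $\|\tilde u\|_{H^6}<\delta$ which has zero mean, $\int_0^{2\pi}\tilde u\,d\xi=0$, solves (1.5) for some constant $q$ (equivalently, solves $-k^2\partial_\xi^2[-(1+k^2\partial_\xi^2)^2u+\varepsilon^2u-su^2-u^3]=0$),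 is even in $\xi$, and satisfies $\tilde u(0)>0$; * if $\omega=\pm\tfrac12$, the only even $\tilde u\in H^6_{per}([0,2\pi],\mathbb R)$ of zero mean with $\|\tilde u\|_{H^6}<\delta$ which solves (1.5) for some constant $q$ is $\tilde u\equiv0$. In both cases $$\Bigl\|\tilde u-6\sqrt{\tfrac{1-4\omega^2}{27-2s^2}}\,\cos\xi\;\varepsilon-\Bigl(-32\,\omega s^2\sqrt{\tfrac{1-4\omega^2}{(27-2s^2)^3}}\,\cos\xi-\tfrac{2s(1-4\omega^2)}{27-2s^2}\cos2\xi\Bigr)\varepsilon^2\Bigr\|_{H^6}\le C\varepsilon^3 .$$ -/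

import Mathlib

noncomputable section

namespace PatternCL

open MeasureTheory

/-- `v` is the `j`-th weak derivative of `u` on the circle `ℝ / 2πℤ`: integration by parts holds
against every smooth `2π`-periodic test function. -/
def HasWeakDeriv (j : ℕ) (u v : ℝ → ℝ) : Prop :=
  ∀ φ : ℝ → ℝ, ContDiff ℝ (⊤ : ℕ∞) φ → Function.Periodic φ (2 * Real.pi) →
    ∫ x in (0 : ℝ)..(2 * Real.pi), u x * iteratedDeriv j φ x =
      (-1) ^ j * ∫ x in (0 : ℝ)..(2 * Real.pi), v x * φ x

/-- `v` is a function in `L²_per([0, 2π], ℝ)`. -/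
def MemL2per (v : ℝ → ℝ) : Prop :=
  Function.Periodic v (2 * Real.pi) ∧
    MemLp v 2 (volume.restrict (Set.Ioc 0 (2 * Real.pi)))

/-- `u` is (the continuous representative of) an element of `H⁶_per([0, 2π], ℝ)`: it is
`2π`-periodic and its weak derivatives up to order six are in `L²`. The continuous representative,
which exists and is unique by Sobolev embedding, gives `u 0` a meaning. -/
structure MemH6per (u : ℝ → ℝ) : Prop where
  continuous : Continuous u
  periodic : Function.Periodic u (2 * Real.pi)
  weakDeriv : ∀ j ≤ 6, ∃ v, MemL2per v ∧ HasWeakDeriv j u v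

open Classical in
/-- The `j`-th weak derivative of `u`, an `L²_per` function that is determined almost everywhere
(and `0` if `u` has no such derivative). -/
def weakDeriv (j : ℕ) (u : ℝ → ℝ) : ℝ → ℝ :=
  if h : ∃ v, MemL2per v ∧ HasWeakDeriv j u v then h.choose else 0

/-- The norm of `H⁶_per([0, 2π], ℝ)`, `(∑_{j ≤ 6} ∫₀^{2π} |∂ʲu|²)^{1/2}`. -/
def h6norm (u : ℝ → ℝ) : ℝ :=
  √(∑ j ∈ Finset.range 7, ∫ x in (0 : ℝ)..(2 * Real.pi), (weakDeriv j u x) ^ 2)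

/-- The operator `1 + k² ∂_ξ²`. -/
def onePlus (k : ℝ) (u : ℝ → ℝ) : ℝ → ℝ :=
  fun ξ => u ξ + k ^ 2 * weakDeriv 2 u ξ

/-- The equation `-k² [-(1 + k² ∂_ξ²)² u + ε² u - s u² - u³] = q`, almost everywhere. -/
def SolvesProfile (ε k s q : ℝ) (u : ℝ → ℝ) : Prop :=
  ∀ᵐ ξ ∂(volume.restrict (Set.Ioc 0 (2 * Real.pi))),
    -k ^ 2 * (-(onePlus k (onePlus k u) ξ) + ε ^ 2 * u ξ - s * u ξ ^ 2 - u ξ ^ 3) = q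

/-- `u` is an even `H⁶_per` function of mean zero that solves the profile equation for some
value of the integration constant `q`. -/
def IsEvenProfile (ε k s : ℝ) (u : ℝ → ℝ) : Prop :=
  MemH6per u ∧ (∀ ξ, u (-ξ) = u ξ) ∧ ∫ ξ in (0 : ℝ)..(2 * Real.pi), u ξ = 0 ∧
    ∃ q : ℝ, SolvesProfile ε k s q u

/-- The explicit part, up to order `ε²`, of the expansion of the solution. -/
def expansion (ε ω s ξ : ℝ) : ℝ :=
  6 * √((1 - 4 * ω ^ 2) / (27 - 2 * s ^ 2)) * Real.cos ξ * ε +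
    (-32 * ω * s ^ 2 * √((1 - 4 * ω ^ 2) / (27 - 2 * s ^ 2) ^ 3) * Real.cos ξ -
      2 * s * (1 - 4 * ω ^ 2) / (27 - 2 * s ^ 2) * Real.cos (2 * ξ)) * ε ^ 2

end PatternCL

end

/-!
Even functions in `H⁶_per` are identified with cosine series `∑ aₙ cos nξ` with
`∑ (1 + n)² |aₙ| < ∞`, a Banach algebra in which the profile equation reads
`λₙ aₙ + (s a² + a³)ₙ = 0` for `n ≠ 0`, where `λₙ = (1 - k²n²)² - ε²`. With `κ = ω ε` one has
`λ₁ = -(ε² - 4κ²)`, which is small, while `|λₙ| ≥ n⁴ / 4` for `n ≥ 2`. Lyapunov–Schmidt reduction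
therefore applies: in `a = A cos ξ + A² w` the part `w` is the fixed point of a contraction that
depends on the amplitude `A` in a Lipschitz way, and the equation on mode `1` becomes, for
`A ≠ 0`, `A² h(A) = ε² - 4κ²`. Here `h(A) = 3/4 - s²/(2 λ₂) + O(A²)` has the limit
`(27 - 2s²)/36 > 0`, so that there is exactly one root `A ≥ 0`. Expanding `1/λ₂` to first order in
`κ` gives the coefficients of the expansion; the error in `h` is `O(A²)` and not merely `O(A)`
because of the parity of the modes that occur.
-/

noncomputable section

namespace PatternCL

open MeasureTheory Real

/-! ### Trigonometric integrals and completeness -/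

/-- Lebesgue measure on the period `(0, 2π]`. -/
abbrev periodMeasure : Measure ℝ := volume.restrict (Set.Ioc 0 (2 * π))

/-- The cosine coefficient `π⁻¹ ∫₀^{2π} f(x) cos(nx) dx`; for `n = 0` it is twice the mean. -/
def cosCoeff (n : ℕ) (f : ℝ → ℝ) : ℝ :=
  π⁻¹ * ∫ x in (0 : ℝ)..(2 * π), f x * cos (n * x)

lemma integral_mul_cos_eq_cosCoeff (n : ℕ) (f : ℝ → ℝ) :
    ∫ x in (0 : ℝ)..(2 * π), f x * cos (n * x) = π * cosCoeff n f := by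
  rw [cosCoeff, mul_inv_cancel_left₀ pi_ne_zero]

lemma integral_cos_int_mul (k : ℤ) :
    ∫ x in (0 : ℝ)..(2 * π), cos (k * x) = if k = 0 then 2 * π else 0 := by
  split_ifs with h
  · simp [h]
  · have hsin : sin (k * (2 * π)) = 0 := by
      simpa [mul_assoc] using sin_int_mul_pi (k * 2)
    rw [intervalIntegral.integral_comp_mul_left (fun x => cos x) (by exact_mod_cast h),
      integral_cos, hsin]
    simp

lemma integral_cos_mul_cos (m n : ℕ) :
    ∫ x in (0 : ℝ)..(2 * π), cos (m * x) * cos (n * x) =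
      if m = n then (if n = 0 then 2 * π else π) else 0 := by
  have product_to_sum : ∀ x : ℝ, cos (m * x) * cos (n * x) =
      (1 / 2) * (cos (((m : ℤ) - n : ℤ) * x) + cos (((m : ℤ) + n : ℤ) * x)) := by
    intro x
    push_cast
    rw [sub_mul, add_mul, cos_sub, cos_add]
    ring
  simp_rw [product_to_sum]
  rw [intervalIntegral.integral_const_mul, intervalIntegral.integral_add
    (by apply Continuous.intervalIntegrable; fun_prop)
    (by apply Continuous.intervalIntegrable; fun_prop), integral_cos_int_mul, integral_cos_int_mul]
  grind

lemma memLp_periodMeasure_of_continuous {f : ℝ → ℝ} (hf : Continuous f) :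
    MemLp f 2 periodMeasure := by
  obtain ⟨C, hC⟩ := (isCompact_Icc (a := 0) (b := 2 * π)).exists_bound_of_continuousOn
    hf.continuousOn
  exact MemLp.of_bound hf.aestronglyMeasurable C ((ae_restrict_iff' measurableSet_Ioc).2
    (Filter.Eventually.of_forall fun x hx => hC x (Set.Ioc_subset_Icc_self hx)))

lemma intervalIntegrable_mul_of_memLp {f g : ℝ → ℝ} (hf : MemLp f 2 periodMeasure)
    (hg : Continuous g) : IntervalIntegrable (fun x => f x * g x) volume 0 (2 * π) := by
  rw [intervalIntegrable_iff_integrableOn_Ioc_of_le two_pi_pos.le]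
  exact hf.integrable_mul (memLp_periodMeasure_of_continuous hg)

lemma sq_integral_mul_le {α : Type*} [MeasurableSpace α] {μ : Measure α} {f g : α → ℝ}
    (hf : MemLp f 2 μ) (hg : MemLp g 2 μ) :
    (∫ x, f x * g x ∂μ) ^ 2 ≤ (∫ x, f x ^ 2 ∂μ) * ∫ x, g x ^ 2 ∂μ := by
  have nonneg_quadratic (t : ℝ) :
      0 ≤ (∫ x, g x ^ 2 ∂μ) * (t * t) + 2 * (∫ x, f x * g x ∂μ) * t + ∫ x, f x ^ 2 ∂μ := by
    calc 0 ≤ ∫ x, (g x ^ 2 * (t * t) + f x * g x * (2 * t) + f x ^ 2) ∂μ :=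
          integral_nonneg fun x => by
            simpa only [Pi.zero_apply] using (sq_nonneg (t * g x + f x)).trans_eq (by ring)
      _ = _ := by
          have hfg : Integrable (fun x => f x * g x * (2 * t)) μ :=
            (hf.integrable_mul hg).mul_const (2 * t)
          have hgg : Integrable (fun x => g x ^ 2 * (t * t)) μ :=
            hg.integrable_sq.mul_const (t * t)
          rw [integral_add (f := fun x => _ + _) (hgg.add hfg) hf.integrable_sq,
            integral_add hgg hfg, integral_mul_const, integral_mul_const]
          ring
  have := discrim_le_zero nonneg_quadratic
  rw [discrim] at this
  linarith

lemma ae_eq_zero_of_fourierCoeffOn_eq_zero {a b : ℝ} (hab : a < b) {f : ℝ → ℂ}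
    (hf : MemLp f 2 (volume.restrict (Set.Ioc a b))) (h : ∀ n, fourierCoeffOn hab f n = 0) :
    f =ᵐ[volume.restrict (Set.Ioc a b)] 0 := by
  have parseval := hasSum_sq_fourierCoeffOn hab hf
  simp only [h, norm_zero, ne_eq, OfNat.ofNat_ne_zero, not_false_eq_true, zero_pow] at parseval
  have norm_eq_zero := (smul_eq_zero.1 (parseval.unique hasSum_zero)).resolve_left
    (inv_ne_zero (sub_pos.2 hab).ne')
  rw [intervalIntegral.integral_of_le hab.le, integral_eq_zero_iff_of_nonneg
    (fun x => by positivity) hf.integrable_norm_pow'] at norm_eq_zero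
  filter_upwards [norm_eq_zero] with x hx
  simpa using hx

lemma fourier_two_pi_mul_ofReal (n : ℤ) (x y : ℝ) :
    fourier (-n) (x : AddCircle (2 * π - 0)) • (y : ℂ) =
      ((y * cos (n * x) : ℝ) : ℂ) + Complex.I * ((y * cos (n * x + π / 2) : ℝ) : ℂ) := by
  have exponent : 2 * (π : ℂ) * Complex.I * ((-n : ℤ) : ℂ) * x / ((2 * π - 0 : ℝ) : ℂ) =
      ((-(n * x) : ℝ) : ℂ) * Complex.I := by
    have : (π : ℂ) ≠ 0 := by exact_mod_cast pi_ne_zero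
    push_cast
    field_simp
    ring
  rw [fourier_coe_apply, cos_add_pi_div_two, smul_eq_mul, exponent, Complex.exp_mul_I,
    ← Complex.ofReal_cos, ← Complex.ofReal_sin]
  simp only [cos_neg, sin_neg, Complex.ofReal_neg, Complex.ofReal_mul, mul_neg]
  ring

lemma fourierCoeffOn_ofReal {f : ℝ → ℝ} (hf : MemLp f 2 periodMeasure) (n : ℤ) :
    fourierCoeffOn two_pi_pos (fun x => (f x : ℂ)) n = (1 / (2 * π) : ℝ) •
      (((∫ x in (0 : ℝ)..(2 * π), f x * cos (n * x) : ℝ) : ℂ) +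
        Complex.I * ((∫ x in (0 : ℝ)..(2 * π), f x * cos (n * x + π / 2) : ℝ) : ℂ)) := by
  have hint (θ : ℝ) : IntervalIntegrable (fun x : ℝ => ((f x * cos (n * x + θ) : ℝ) : ℂ))
      volume 0 (2 * π) :=
    ⟨(intervalIntegrable_mul_of_memLp hf (by fun_prop)).1.ofReal,
      (intervalIntegrable_mul_of_memLp hf (by fun_prop)).2.ofReal⟩
  rw [fourierCoeffOn_eq_integral]
  simp_rw [fourier_two_pi_mul_ofReal]
  rw [intervalIntegral.integral_add (by simpa only [add_zero] using hint 0)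
    ((hint (π / 2)).const_mul _), intervalIntegral.integral_const_mul,
    intervalIntegral.integral_ofReal, intervalIntegral.integral_ofReal, sub_zero]

lemma ae_eq_zero_of_integral_mul_cos_add_eq_zero {f : ℝ → ℝ} (hf : MemLp f 2 periodMeasure)
    (h : ∀ (n : ℕ) (θ : ℝ), ∫ x in (0 : ℝ)..(2 * π), f x * cos (n * x + θ) = 0) :
    f =ᵐ[periodMeasure] 0 := by
  have hint (n : ℤ) (θ : ℝ) : ∫ x in (0 : ℝ)..(2 * π), f x * cos (n * x + θ) = 0 := by
    obtain ⟨m, rfl | rfl⟩ := n.eq_nat_or_neg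
    · simpa using h m θ
    · refine .trans (intervalIntegral.integral_congr fun x _ => ?_) (h m (-θ))
      rw [← cos_neg]
      push_cast
      ring_nf
  have coeff_eq_zero (n : ℤ) : fourierCoeffOn two_pi_pos (fun x => (f x : ℂ)) n = 0 := by
    have h0 := hint n 0
    simp only [add_zero] at h0
    rw [fourierCoeffOn_ofReal hf, h0, hint]
    simp
  filter_upwards [ae_eq_zero_of_fourierCoeffOn_eq_zero two_pi_pos hf.ofReal coeff_eq_zero]
    with x hx
  simpa using hx

lemma ae_eq_of_integral_mul_cos_add_eq {f g : ℝ → ℝ}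
    (hf : MemLp f 2 periodMeasure) (hg : MemLp g 2 periodMeasure)
    (h : ∀ (n : ℕ) (θ : ℝ), ∫ x in (0 : ℝ)..(2 * π), f x * cos (n * x + θ) =
      ∫ x in (0 : ℝ)..(2 * π), g x * cos (n * x + θ)) :
    f =ᵐ[periodMeasure] g := by
  refine Filter.eventuallyEq_iff_sub.2
    (ae_eq_zero_of_integral_mul_cos_add_eq_zero (hf.sub hg) fun n θ => ?_)
  simp only [Pi.sub_apply, sub_mul]
  rw [intervalIntegral.integral_sub (intervalIntegrable_mul_of_memLp hf (by fun_prop))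
    (intervalIntegrable_mul_of_memLp hg (by fun_prop)), h, sub_self]

lemma eq_of_ae_eq_of_periodic {f g : ℝ → ℝ} (hf : Continuous f) (hg : Continuous g)
    (pf : Function.Periodic f (2 * π)) (pg : Function.Periodic g (2 * π))
    (h : f =ᵐ[periodMeasure] g) : f = g := by
  have heq : Set.EqOn f g (Set.Ioc 0 (2 * π)) :=
    Measure.eqOn_Ioc_of_ae_eq volume h hf.continuousOn hg.continuousOn
  ext x
  obtain ⟨y, hy, hxy⟩ := (pf.sub pg).exists_mem_Ioc two_pi_pos x 0
  rw [zero_add] at hy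
  rwa [Pi.sub_apply, Pi.sub_apply, heq hy, sub_self, sub_eq_zero] at hxy

lemma integral_mul_sin_eq_zero_of_even {f : ℝ → ℝ} (he : ∀ x, f (-x) = f x)
    (hp : Function.Periodic f (2 * π)) (n : ℕ) :
    ∫ x in (0 : ℝ)..(2 * π), f x * sin (n * x) = 0 := by
  have reflect := intervalIntegral.integral_comp_sub_left (a := 0) (b := 2 * π)
    (fun x => f x * sin (n * x)) (2 * π)
  have hodd (x : ℝ) : f (2 * π - x) * sin (n * (2 * π - x)) = -(f x * sin (n * x)) := by
    rw [sub_eq_neg_add, hp, he, mul_add, sin_add_nat_mul_two_pi, mul_neg, sin_neg, mul_neg]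
  simp_rw [hodd, intervalIntegral.integral_neg, sub_self, sub_zero] at reflect
  linarith

lemma integral_mul_cos_add_of_even {f : ℝ → ℝ} (hf : Continuous f) (he : ∀ x, f (-x) = f x)
    (hp : Function.Periodic f (2 * π)) (n : ℕ) (θ : ℝ) :
    ∫ x in (0 : ℝ)..(2 * π), f x * cos (n * x + θ) = cos θ * (π * cosCoeff n f) := by
  have expand (x : ℝ) : f x * cos (n * x + θ) =
      cos θ * (f x * cos (n * x)) - sin θ * (f x * sin (n * x)) := by
    rw [cos_add]; ring
  simp_rw [expand]
  rw [intervalIntegral.integral_sub (by apply Continuous.intervalIntegrable; fun_prop)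
      (by apply Continuous.intervalIntegrable; fun_prop), intervalIntegral.integral_const_mul,
    intervalIntegral.integral_const_mul, integral_mul_sin_eq_zero_of_even he hp,
    integral_mul_cos_eq_cosCoeff, mul_zero, sub_zero]

lemma cosCoeff_const (c : ℝ) {n : ℕ} (hn : n ≠ 0) : cosCoeff n (fun _ => c) = 0 := by
  have := integral_cos_int_mul n
  rw [if_neg (by exact_mod_cast hn), Int.cast_natCast] at this
  rw [cosCoeff, intervalIntegral.integral_const_mul, this, mul_zero, mul_zero]

/-! ### Weak derivatives and the profile equation -/

lemma periodic_iteratedDeriv {f : ℝ → ℝ} {T : ℝ} (h : Function.Periodic f T) (j : ℕ) :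
    Function.Periodic (iteratedDeriv j f) T := fun x => by
  rw [← congrFun (iteratedDeriv_comp_add_const j f T) x, funext h]

lemma integral_mul_deriv_of_periodic {f g : ℝ → ℝ} {T : ℝ} (hf : ContDiff ℝ 1 f)
    (hg : ContDiff ℝ 1 g) (pf : Function.Periodic f T) (pg : Function.Periodic g T) :
    ∫ x in (0 : ℝ)..T, f x * deriv g x = -∫ x in (0 : ℝ)..T, deriv f x * g x := by
  have hf0 : f T = f 0 := by simpa using pf 0
  have hg0 : g T = g 0 := by simpa using pg 0
  rw [intervalIntegral.integral_mul_deriv_eq_deriv_mul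
    (fun x _ => (hf.differentiable one_ne_zero x).hasDerivAt)
    (fun x _ => (hg.differentiable one_ne_zero x).hasDerivAt)
    ((hf.continuous_deriv le_rfl).intervalIntegrable _ _)
    ((hg.continuous_deriv le_rfl).intervalIntegrable _ _), hf0, hg0, sub_self, zero_sub]

lemma integral_mul_iteratedDeriv_of_periodic {f g : ℝ → ℝ} {T : ℝ} {j : ℕ} (hf : ContDiff ℝ j f)
    (hg : ContDiff ℝ j g) (pf : Function.Periodic f T) (pg : Function.Periodic g T) :
    ∫ x in (0 : ℝ)..T, f x * iteratedDeriv j g x =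
      (-1) ^ j * ∫ x in (0 : ℝ)..T, iteratedDeriv j f x * g x := by
  induction j generalizing f with
  | zero => simp
  | succ j ih =>
    have hf' : ContDiff ℝ j (deriv f) := (contDiff_succ_iff_deriv.1 (by exact_mod_cast hf)).2.2
    have pf' : Function.Periodic (deriv f) T := by simpa using periodic_iteratedDeriv pf 1
    have hgj : ContDiff ℝ 1 (iteratedDeriv j g) := by
      rw [iteratedDeriv_eq_iterate]
      exact ContDiff.iterate_deriv' 1 j (by simpa [add_comm] using hg)
    have hf1 : ContDiff ℝ 1 f := hf.of_le (by norm_cast; omega)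
    rw [iteratedDeriv_succ,
      integral_mul_deriv_of_periodic hf1 hgj pf (periodic_iteratedDeriv pg j),
      ih hf' (hg.of_le (by norm_cast; omega)) pf', iteratedDeriv_succ', pow_succ]
    ring

lemma hasWeakDeriv_iteratedDeriv {u : ℝ → ℝ} {j : ℕ} (hu : ContDiff ℝ j u)
    (pu : Function.Periodic u (2 * π)) : HasWeakDeriv j u (iteratedDeriv j u) :=
  fun _ hφ pφ => integral_mul_iteratedDeriv_of_periodic hu (hφ.of_le (by exact_mod_cast le_top))
    pu pφ

lemma periodic_cos_mul_add (n : ℕ) (θ : ℝ) :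
    Function.Periodic (fun x => cos (n * x + θ)) (2 * π) := fun x => by
  simp only [mul_add, add_right_comm _ _ θ, cos_add_nat_mul_two_pi]

lemma HasWeakDeriv.unique {j : ℕ} {u v w : ℝ → ℝ} (hv : HasWeakDeriv j u v)
    (hw : HasWeakDeriv j u w) (mv : MemLp v 2 periodMeasure) (mw : MemLp w 2 periodMeasure) :
    v =ᵐ[periodMeasure] w := by
  refine ae_eq_of_integral_mul_cos_add_eq mv mw fun n θ => ?_
  have := (hv _ (by fun_prop) (periodic_cos_mul_add n θ)).symm.trans
    (hw _ (by fun_prop) (periodic_cos_mul_add n θ))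
  exact mul_left_cancel₀ (pow_ne_zero _ (by norm_num)) this

lemma memL2per_weakDeriv {j : ℕ} {u : ℝ → ℝ} (h : ∃ v, MemL2per v ∧ HasWeakDeriv j u v) :
    MemL2per (weakDeriv j u) := by
  rw [weakDeriv, dif_pos h]
  exact h.choose_spec.1

lemma hasWeakDeriv_weakDeriv {j : ℕ} {u : ℝ → ℝ} (h : ∃ v, MemL2per v ∧ HasWeakDeriv j u v) :
    HasWeakDeriv j u (weakDeriv j u) := by
  rw [weakDeriv, dif_pos h]
  exact h.choose_spec.2

lemma weakDeriv_ae_eq_iteratedDeriv {u : ℝ → ℝ} {j : ℕ} (hu : ContDiff ℝ j u)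
    (pu : Function.Periodic u (2 * π)) : weakDeriv j u =ᵐ[periodMeasure] iteratedDeriv j u := by
  have mu := memLp_periodMeasure_of_continuous (hu.continuous_iteratedDeriv' j)
  have h := hasWeakDeriv_iteratedDeriv hu pu
  have hex : ∃ v, MemL2per v ∧ HasWeakDeriv j u v := ⟨_, ⟨periodic_iteratedDeriv pu j, mu⟩, h⟩
  exact (hasWeakDeriv_weakDeriv hex).unique h (memL2per_weakDeriv hex).2 mu

lemma iteratedDeriv_cos_mul_add (n θ : ℝ) (j : ℕ) :
    iteratedDeriv j (fun x => cos (n * x + θ)) =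
      fun x => n ^ j * iteratedDeriv j cos (n * x + θ) := by
  rw [iteratedDeriv_comp_const_mul (f := fun x => cos (x + θ)) (by fun_prop)]
  simp_rw [iteratedDeriv_comp_add_const]

lemma HasWeakDeriv.integral_mul_cos_add {i : ℕ} {u v : ℝ → ℝ} (h : HasWeakDeriv (2 * i) u v)
    (n : ℕ) (θ : ℝ) :
    ∫ x in (0 : ℝ)..(2 * π), v x * cos (n * x + θ) =
      (-n ^ 2) ^ i * ∫ x in (0 : ℝ)..(2 * π), u x * cos (n * x + θ) := by
  have parts := h (fun x => cos (n * x + θ)) (by fun_prop) (periodic_cos_mul_add n θ)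
  simp only [iteratedDeriv_cos_mul_add, iteratedDeriv_even_cos, pow_mul, even_two, Even.neg_pow,
    one_pow, one_mul] at parts
  rw [← parts, ← intervalIntegral.integral_const_mul]
  refine intervalIntegral.integral_congr fun x _ => ?_
  simp only [Pi.mul_apply, Pi.pow_apply, Pi.neg_apply, Pi.one_apply]
  rw [neg_pow (n ^ 2 : ℝ)]
  ring

lemma memL2per_onePlus {k : ℝ} {u : ℝ → ℝ} (hu : MemL2per u)
    (h : ∃ v, MemL2per v ∧ HasWeakDeriv 2 u v) : MemL2per (onePlus k u) := by
  have hd := memL2per_weakDeriv h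
  exact ⟨fun x => by simp only [onePlus, hu.1 x, hd.1 x], hu.2.add (hd.2.const_mul (k ^ 2))⟩

lemma integral_onePlus_mul {k : ℝ} {u φ : ℝ → ℝ} (hu : MemL2per u)
    (h : ∃ v, MemL2per v ∧ HasWeakDeriv 2 u v) (hφ : Continuous φ) :
    ∫ x in (0 : ℝ)..(2 * π), onePlus k u x * φ x =
      (∫ x in (0 : ℝ)..(2 * π), u x * φ x) +
        k ^ 2 * ∫ x in (0 : ℝ)..(2 * π), weakDeriv 2 u x * φ x := by
  simp only [onePlus, add_mul, mul_assoc]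
  rw [intervalIntegral.integral_add (intervalIntegrable_mul_of_memLp hu.2 hφ)
    ((intervalIntegrable_mul_of_memLp (memL2per_weakDeriv h).2 hφ).const_mul _),
    intervalIntegral.integral_const_mul]

lemma integral_onePlus_mul_cos_add {k : ℝ} {u : ℝ → ℝ} (hu : MemL2per u)
    (h : ∃ v, MemL2per v ∧ HasWeakDeriv 2 u v) (n : ℕ) (θ : ℝ) :
    ∫ x in (0 : ℝ)..(2 * π), onePlus k u x * cos (n * x + θ) =
      (1 - k ^ 2 * n ^ 2) * ∫ x in (0 : ℝ)..(2 * π), u x * cos (n * x + θ) := by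
  rw [integral_onePlus_mul hu h (by fun_prop),
    (hasWeakDeriv_weakDeriv h).integral_mul_cos_add (i := 1)]
  ring

lemma MemH6per.memL2per {u : ℝ → ℝ} (hu : MemH6per u) : MemL2per u :=
  ⟨hu.periodic, memLp_periodMeasure_of_continuous hu.continuous⟩

lemma MemH6per.exists_weakDeriv_onePlus {u : ℝ → ℝ} (hu : MemH6per u) (k : ℝ) :
    ∃ v, MemL2per v ∧ HasWeakDeriv 2 (onePlus k u) v := by
  have hu2 := hu.weakDeriv 2 (by norm_num)
  have hu4 := hu.weakDeriv 4 (by norm_num)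
  have m2 := memL2per_weakDeriv hu2
  have m4 := memL2per_weakDeriv hu4
  refine ⟨fun x => PatternCL.weakDeriv 2 u x + k ^ 2 * PatternCL.weakDeriv 4 u x,
    ⟨fun x => by simp only [m2.1 x, m4.1 x], m2.2.add (m4.2.const_mul (k ^ 2))⟩, ?_⟩
  intro φ hφ pφ
  have hφ2 : ContDiff ℝ (⊤ : ℕ∞) (iteratedDeriv 2 φ) := by
    rw [iteratedDeriv_eq_iterate]
    exact hφ.iterate_deriv 2
  have iteratedDeriv_two_two : iteratedDeriv 2 (iteratedDeriv 2 φ) = iteratedDeriv 4 φ := by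
    simp only [iteratedDeriv_eq_iterate, ← Function.iterate_add_apply]
  have weak2 := hasWeakDeriv_weakDeriv hu2 φ hφ pφ
  have weak2' := hasWeakDeriv_weakDeriv hu2 _ hφ2 (periodic_iteratedDeriv pφ 2)
  have weak4 := hasWeakDeriv_weakDeriv hu4 φ hφ pφ
  rw [iteratedDeriv_two_two] at weak2'
  rw [integral_onePlus_mul hu.memL2per hu2 hφ2.continuous]
  simp only [add_mul, mul_assoc]
  rw [intervalIntegral.integral_add (intervalIntegrable_mul_of_memLp m2.2 hφ.continuous)
      ((intervalIntegrable_mul_of_memLp m4.2 hφ.continuous).const_mul _),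
    intervalIntegral.integral_const_mul]
  linear_combination weak2 - k ^ 2 * weak2' + k ^ 2 * weak4

lemma MemH6per.memL2per_onePlus_onePlus {u : ℝ → ℝ} (hu : MemH6per u) (k : ℝ) :
    MemL2per (onePlus k (onePlus k u)) :=
  memL2per_onePlus (memL2per_onePlus hu.memL2per (hu.weakDeriv 2 (by norm_num)))
    (hu.exists_weakDeriv_onePlus k)

lemma MemH6per.integral_onePlus_onePlus_mul_cos_add {u : ℝ → ℝ} (hu : MemH6per u) (k : ℝ) (n : ℕ)
    (θ : ℝ) :
    ∫ x in (0 : ℝ)..(2 * π), onePlus k (onePlus k u) x * cos (n * x + θ) =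
      (1 - k ^ 2 * n ^ 2) ^ 2 * ∫ x in (0 : ℝ)..(2 * π), u x * cos (n * x + θ) := by
  rw [integral_onePlus_mul_cos_add (memL2per_onePlus hu.memL2per (hu.weakDeriv 2 (by norm_num)))
      (hu.exists_weakDeriv_onePlus k),
    integral_onePlus_mul_cos_add hu.memL2per (hu.weakDeriv 2 (by norm_num))]
  ring

/-- The multiplier `(1 - k²n²)² - ε²` by which the linear operator `(1 + k²∂²)² - ε²` acts on
`cos(nξ)`. -/
def symbol (k ε : ℝ) (n : ℕ) : ℝ := (1 - k ^ 2 * n ^ 2) ^ 2 - ε ^ 2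

/-- The function `(1 + k²∂²)² u - ε² u + s u² + u³`; the profile equation with constant `q` says
that it equals `q / k²`. -/
def profileOp (ε k s : ℝ) (u : ℝ → ℝ) (ξ : ℝ) : ℝ :=
  onePlus k (onePlus k u) ξ - ε ^ 2 * u ξ + (s * u ξ ^ 2 + u ξ ^ 3)

lemma solvesProfile_iff_profileOp_ae_eq {ε k s q : ℝ} (hk : k ≠ 0) {u : ℝ → ℝ} :
    SolvesProfile ε k s q u ↔ profileOp ε k s u =ᵐ[periodMeasure] fun _ => q / k ^ 2 := by
  refine Filter.eventually_congr (Filter.Eventually.of_forall fun ξ => ?_)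
  rw [profileOp, eq_div_iff (pow_ne_zero 2 hk)]
  constructor <;> intro h <;> linear_combination h

lemma MemH6per.memLp_profileOp {u : ℝ → ℝ} (hu : MemH6per u) (ε k s : ℝ) :
    MemLp (profileOp ε k s u) 2 periodMeasure := by
  have hc := hu.continuous
  exact ((hu.memL2per_onePlus_onePlus k).2.sub (hu.memL2per.2.const_mul (ε ^ 2))).add
    (memLp_periodMeasure_of_continuous (by fun_prop))

lemma MemH6per.integral_profileOp_mul_cos_add {u : ℝ → ℝ} (hu : MemH6per u)
    (he : ∀ ξ, u (-ξ) = u ξ) (ε k s : ℝ) (n : ℕ) (θ : ℝ) :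
    ∫ x in (0 : ℝ)..(2 * π), profileOp ε k s u x * cos (n * x + θ) =
      cos θ * (π * (symbol k ε n * cosCoeff n u +
        cosCoeff n (fun ξ => s * u ξ ^ 2 + u ξ ^ 3))) := by
  have hc := hu.continuous
  have expand (x : ℝ) : profileOp ε k s u x * cos (n * x + θ) =
      onePlus k (onePlus k u) x * cos (n * x + θ) - ε ^ 2 * (u x * cos (n * x + θ)) +
        (s * u x ^ 2 + u x ^ 3) * cos (n * x + θ) := by
    rw [profileOp]; ring
  have int_linear : IntervalIntegrable (fun x => onePlus k (onePlus k u) x * cos (n * x + θ))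
      volume 0 (2 * π) :=
    intervalIntegrable_mul_of_memLp (hu.memL2per_onePlus_onePlus k).2 (by fun_prop)
  have int_u : IntervalIntegrable (fun x => ε ^ 2 * (u x * cos (n * x + θ))) volume 0 (2 * π) := by
    apply Continuous.intervalIntegrable; fun_prop
  simp_rw [expand]
  rw [intervalIntegral.integral_add (int_linear.sub int_u)
      (by apply Continuous.intervalIntegrable; fun_prop),
    intervalIntegral.integral_sub int_linear int_u, intervalIntegral.integral_const_mul,
    hu.integral_onePlus_onePlus_mul_cos_add, integral_mul_cos_add_of_even hc he hu.periodic,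
    integral_mul_cos_add_of_even (by fun_prop) (fun ξ => by simp only [he])
      (fun ξ => by simp only [hu.periodic ξ]), symbol]
  ring

lemma MemH6per.exists_solvesProfile_iff {ε k s : ℝ} (hk : k ≠ 0) {u : ℝ → ℝ} (hu : MemH6per u)
    (he : ∀ ξ, u (-ξ) = u ξ) :
    (∃ q, SolvesProfile ε k s q u) ↔ ∀ n : ℕ, n ≠ 0 →
      symbol k ε n * cosCoeff n u + cosCoeff n (fun ξ => s * u ξ ^ 2 + u ξ ^ 3) = 0 := by
  have integral_const (c : ℝ) (n : ℕ) (θ : ℝ) :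
      ∫ x in (0 : ℝ)..(2 * π), c * cos (n * x + θ) = cos θ * (π * cosCoeff n fun _ => c) :=
    integral_mul_cos_add_of_even continuous_const (fun _ => rfl) (fun _ => rfl) n θ
  have hint := hu.integral_profileOp_mul_cos_add he ε k s
  simp_rw [solvesProfile_iff_profileOp_ae_eq hk]
  constructor
  · rintro ⟨q, hq⟩ n hn
    have heq : ∫ x in (0 : ℝ)..(2 * π), profileOp ε k s u x * cos (n * x + 0) =
        ∫ x in (0 : ℝ)..(2 * π), q / k ^ 2 * cos (n * x + 0) := by
      apply intervalIntegral.integral_congr_ae_restrict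
      rw [Set.uIoc_of_le two_pi_pos.le]
      filter_upwards [hq] with x hx
      rw [hx]
    rw [integral_const, cosCoeff_const _ hn, hint, cos_zero, one_mul, one_mul, mul_zero] at heq
    exact (mul_eq_zero.1 heq).resolve_left pi_ne_zero
  · intro h
    set mean : ℝ := (2 * π)⁻¹ * ∫ x in (0 : ℝ)..(2 * π), profileOp ε k s u x
    refine ⟨mean * k ^ 2, ?_⟩
    rw [mul_div_cancel_right₀ _ (pow_ne_zero 2 hk)]
    refine ae_eq_of_integral_mul_cos_add_eq (hu.memLp_profileOp ε k s) (memLp_const mean)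
      fun n θ => ?_
    rcases eq_or_ne n 0 with rfl | hn
    · simp only [CharP.cast_eq_zero, zero_mul, zero_add, intervalIntegral.integral_mul_const,
        intervalIntegral.integral_const, sub_zero, smul_eq_mul, mean]
      rw [mul_inv_cancel₀ two_pi_pos.ne', one_mul]
    · rw [hint, h n hn, integral_const, cosCoeff_const _ hn]

/-! ### The algebra of cosine series -/

/-- The space of cosine series `∑ cₙ cos(nξ)` with `∑ (1 + n)² |cₙ| < ∞`, normed by this sum; the
sequence `(1 + n)² cₙ` in `ℓ¹` is stored. The weight is submultiplicative, which makes the space a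
Banach algebra, and dividing `cₙ` by `n⁴` turns it into the weight `(1 + n)⁶` of `H⁶`. -/
def CosSeq : Type := lp (fun _ : ℕ => ℝ) 1

namespace CosSeq

instance : NormedAddCommGroup CosSeq :=
  inferInstanceAs (NormedAddCommGroup (lp (fun _ : ℕ => ℝ) 1))

instance : NormedSpace ℝ CosSeq := inferInstanceAs (NormedSpace ℝ (lp (fun _ : ℕ => ℝ) 1))

instance : CompleteSpace CosSeq := inferInstanceAs (CompleteSpace (lp (fun _ : ℕ => ℝ) 1))

lemma weight_pos (n : ℕ) : (0 : ℝ) < (1 + n) ^ 2 := by positivity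

/-- The coefficient of `cos(nξ)`. -/
def coef (n : ℕ) : CosSeq →ₗ[ℝ] ℝ where
  toFun a := a.1 n / (1 + n) ^ 2
  map_add' _ _ := add_div _ _ _
  map_smul' _ _ := mul_div_assoc _ _ _

lemma apply_eq_mul_coef (a : CosSeq) (n : ℕ) : a.1 n = (1 + n) ^ 2 * coef n a :=
  (mul_div_cancel₀ (a.1 n) (weight_pos n).ne').symm

lemma abs_apply (a : CosSeq) (n : ℕ) : |a.1 n| = (1 + n) ^ 2 * |coef n a| := by
  rw [apply_eq_mul_coef, abs_mul, abs_of_pos (weight_pos n)]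

lemma ext_coef {a b : CosSeq} (h : ∀ n, coef n a = coef n b) : a = b :=
  lp.ext (funext fun n => by
    change a.1 n = b.1 n
    rw [apply_eq_mul_coef, apply_eq_mul_coef, h n])

lemma summable_weight_mul_abs_coef (a : CosSeq) :
    Summable fun n : ℕ => (1 + n) ^ 2 * |coef n a| := by
  simpa [← abs_apply] using (lp.memℓp a).summable (by simp)

lemma norm_eq (a : CosSeq) : ‖a‖ = ∑' n : ℕ, (1 + n) ^ 2 * |coef n a| := by
  refine (lp.norm_eq_tsum_rpow (by simp) (a : lp (fun _ : ℕ => ℝ) 1)).trans ?_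
  simp [← abs_apply]

/-- The cosine series with a given sequence of coefficients. -/
def ofCoef (c : ℕ → ℝ) (hc : Summable fun n : ℕ => (1 + n) ^ 2 * |c n|) : CosSeq :=
  ⟨fun n => (1 + n) ^ 2 * c n, memℓp_gen (by simpa [abs_mul] using hc)⟩

@[simp] lemma coef_ofCoef (c : ℕ → ℝ) (hc) (n : ℕ) : coef n (ofCoef c hc) = c n :=
  mul_div_cancel_left₀ (c n) (weight_pos n).ne'

lemma abs_coef_le_weight_mul (n : ℕ) (a : CosSeq) : |coef n a| ≤ (1 + n) ^ 2 * |coef n a| :=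
  le_mul_of_one_le_left (abs_nonneg _) (one_le_pow₀ (by simp))

lemma abs_coef_le (n : ℕ) (a : CosSeq) : |coef n a| ≤ ‖a‖ := by
  rw [norm_eq]
  exact (abs_coef_le_weight_mul n a).trans
    (a.summable_weight_mul_abs_coef.le_tsum n fun _ _ => by positivity)

lemma summable_abs_coef (a : CosSeq) : Summable fun n => |coef n a| :=
  a.summable_weight_mul_abs_coef.of_nonneg_of_le (fun _ => abs_nonneg _)
    fun n => abs_coef_le_weight_mul n a

/-- The sum `∑ cₙ cos(nξ)` of a cosine series. -/
def toFun (a : CosSeq) (ξ : ℝ) : ℝ := ∑' n : ℕ, coef n a * cos (n * ξ)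

lemma norm_coef_mul_cos_le (a : CosSeq) (n : ℕ) (ξ : ℝ) :
    ‖coef n a * cos (n * ξ)‖ ≤ |coef n a| := by
  rw [norm_mul]
  exact mul_le_of_le_one_right (norm_nonneg _) (abs_cos_le_one _)

lemma summable_toFun (a : CosSeq) (ξ : ℝ) : Summable fun n : ℕ => coef n a * cos (n * ξ) :=
  a.summable_abs_coef.of_norm_bounded fun n => a.norm_coef_mul_cos_le n ξ

lemma abs_toFun_le (a : CosSeq) (ξ : ℝ) : |toFun a ξ| ≤ ‖a‖ := by
  rw [norm_eq, ← Real.norm_eq_abs]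
  exact tsum_of_norm_bounded a.summable_weight_mul_abs_coef.hasSum fun n =>
    (a.norm_coef_mul_cos_le n ξ).trans (abs_coef_le_weight_mul n a)

/-- Evaluation of the sum of the series at a point. -/
def eval (ξ : ℝ) : CosSeq →L[ℝ] ℝ :=
  LinearMap.mkContinuous
    { toFun := fun a => toFun a ξ
      map_add' := fun a b => by
        simp only [toFun, map_add, add_mul]
        exact (a.summable_toFun ξ).tsum_add (b.summable_toFun ξ)
      map_smul' := fun t a => by
        simp only [toFun, map_smul, smul_eq_mul, mul_assoc, tsum_mul_left, RingHom.id_apply] } 1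
    fun a => (abs_toFun_le a ξ).trans_eq (one_mul _).symm

lemma eval_apply (ξ : ℝ) (a : CosSeq) : eval ξ a = toFun a ξ := rfl

@[simp] lemma toFun_add (a b : CosSeq) (ξ : ℝ) : toFun (a + b) ξ = toFun a ξ + toFun b ξ :=
  map_add (eval ξ) a b

@[simp] lemma toFun_smul (t : ℝ) (a : CosSeq) (ξ : ℝ) : toFun (t • a) ξ = t * toFun a ξ :=
  map_smul (eval ξ) t a

@[simp] lemma toFun_sub (a b : CosSeq) (ξ : ℝ) : toFun (a - b) ξ = toFun a ξ - toFun b ξ :=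
  map_sub (eval ξ) a b

@[simp] lemma toFun_zero (ξ : ℝ) : toFun 0 ξ = 0 := map_zero (eval ξ)

lemma continuous_toFun (a : CosSeq) : Continuous (toFun a) :=
  continuous_tsum (fun n => by fun_prop) a.summable_abs_coef a.norm_coef_mul_cos_le

lemma toFun_neg_arg (a : CosSeq) (ξ : ℝ) : toFun a (-ξ) = toFun a ξ := by simp [toFun]

lemma periodic_toFun (a : CosSeq) : Function.Periodic (toFun a) (2 * π) := fun ξ => by
  simp only [toFun, mul_add, cos_add_nat_mul_two_pi]

lemma integral_toFun_mul_cos (a : CosSeq) (n : ℕ) :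
    ∫ x in (0 : ℝ)..(2 * π), toFun a x * cos (n * x) =
      coef n a * if n = 0 then 2 * π else π := by
  have bound (m : ℕ) (x : ℝ) : ‖coef m a * cos (m * x) * cos (n * x)‖ ≤ |coef m a| := by
    rw [norm_mul]
    exact (mul_le_of_le_one_right (norm_nonneg _) (abs_cos_le_one _)).trans
      (a.norm_coef_mul_cos_le m x)
  have termwise := intervalIntegral.hasSum_integral_of_dominated_convergence (μ := volume)
    (a := 0) (b := 2 * π) (fun m _ => |coef m a|)
    (fun m => Continuous.aestronglyMeasurable (by fun_prop))
    (fun m => .of_forall fun x _ => bound m x) (.of_forall fun _ _ => a.summable_abs_coef)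
    intervalIntegrable_const
    (.of_forall fun x _ => (a.summable_toFun x).hasSum.mul_right (cos (n * x)))
  simp only [mul_assoc, intervalIntegral.integral_const_mul, integral_cos_mul_cos] at termwise
  have single_term := hasSum_single
    (f := fun m => coef m a * if m = n then if n = 0 then 2 * π else π else 0) n
    fun m hm => by rw [if_neg hm, mul_zero]
  rw [if_pos rfl] at single_term
  exact termwise.unique single_term

lemma cosCoeff_toFun (a : CosSeq) {n : ℕ} (hn : n ≠ 0) : cosCoeff n (toFun a) = coef n a := by
  rw [cosCoeff, integral_toFun_mul_cos, if_neg hn, mul_comm, mul_inv_cancel_right₀ pi_ne_zero]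

lemma integral_toFun (a : CosSeq) : ∫ x in (0 : ℝ)..(2 * π), toFun a x = coef 0 a * (2 * π) := by
  simpa using integral_toFun_mul_cos a 0

lemma toFun_injective : Function.Injective toFun := fun a b h => ext_coef fun n => by
  have := integral_toFun_mul_cos a n
  rw [h, integral_toFun_mul_cos] at this
  exact (mul_right_cancel₀ (by split_ifs <;> positivity) this).symm

lemma ext_toFun {a b : CosSeq} (h : ∀ ξ, toFun a ξ = toFun b ξ) : a = b :=
  toFun_injective (funext h)

/-- The series `cos(nξ)` with a single term. -/
def e (n : ℕ) : CosSeq :=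
  ofCoef (Pi.single n 1) (summable_of_ne_finset_zero (s := {n}) fun m hm => by
    simp [Pi.single_eq_of_ne (Finset.notMem_singleton.1 hm)])

lemma coef_e (m n : ℕ) : coef m (e n) = if m = n then 1 else 0 := by
  rw [e, coef_ofCoef, Pi.single_apply]

@[simp] lemma norm_e (n : ℕ) : ‖e n‖ = (1 + n) ^ 2 := by
  rw [norm_eq, tsum_eq_single n fun m hm => by simp [coef_e, hm]]
  simp [coef_e]

@[simp] lemma toFun_e (n : ℕ) (ξ : ℝ) : toFun (e n) ξ = cos (n * ξ) := by
  rw [toFun, tsum_eq_single n fun m hm => by simp [coef_e, hm]]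
  simp [coef_e]

/-- The product `cos(mξ) cos(nξ) = (cos((m + n)ξ) + cos((m - n)ξ)) / 2` as a cosine series. -/
def basisMul (m n : ℕ) : CosSeq := (1 / 2 : ℝ) • (e (m + n) + e (m - n : ℤ).natAbs)

lemma toFun_basisMul (m n : ℕ) (ξ : ℝ) :
    toFun (basisMul m n) ξ = cos (m * ξ) * cos (n * ξ) := by
  have cos_natAbs : cos ((m - n : ℤ).natAbs * ξ) = cos ((m - n) * ξ) := by
    rw [Nat.cast_natAbs, Int.cast_abs]
    push_cast
    rcases abs_choice ((m : ℝ) - n) with h | h <;> simp [h, neg_mul, -neg_sub]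
  simp only [basisMul, toFun_smul, toFun_add, toFun_e, cos_natAbs, Nat.cast_add]
  rw [add_mul, sub_mul, cos_add, cos_sub]
  ring

lemma norm_basisMul_le (m n : ℕ) : ‖basisMul m n‖ ≤ (1 + m) ^ 2 * (1 + n) ^ 2 := by
  have norm_e_le {j : ℕ} (hj : j ≤ m + n) : ‖e j‖ ≤ (1 + m) ^ 2 * (1 + n) ^ 2 := by
    rw [norm_e, ← mul_pow]
    gcongr
    calc (1 + j : ℝ) ≤ 1 + (m + n : ℕ) := by gcongr
      _ ≤ (1 + m) * (1 + n) := by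
        push_cast
        nlinarith [m.cast_nonneg (α := ℝ), n.cast_nonneg (α := ℝ)]
  rw [basisMul, norm_smul, Real.norm_of_nonneg one_half_pos.le]
  linarith [norm_add_le (e (m + n)) (e (m - n : ℤ).natAbs), norm_e_le le_rfl,
    norm_e_le (j := (m - n : ℤ).natAbs) (by omega)]

lemma norm_smul_basisMul_le (a b : CosSeq) (p : ℕ × ℕ) :
    ‖(coef p.1 a * coef p.2 b) • basisMul p.1 p.2‖ ≤
      (1 + p.1) ^ 2 * |coef p.1 a| * ((1 + p.2) ^ 2 * |coef p.2 b|) := by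
  rw [norm_smul, norm_mul, Real.norm_eq_abs, Real.norm_eq_abs]
  refine (mul_le_mul_of_nonneg_left (norm_basisMul_le _ _) (by positivity)).trans_eq ?_
  ring

lemma summable_weight_mul_weight (a b : CosSeq) : Summable fun p : ℕ × ℕ =>
    (1 + p.1) ^ 2 * |coef p.1 a| * ((1 + p.2) ^ 2 * |coef p.2 b|) :=
  a.summable_weight_mul_abs_coef.mul_of_nonneg b.summable_weight_mul_abs_coef
    (fun _ => by positivity) (fun _ => by positivity)

instance : Mul CosSeq where
  mul a b := ∑' p : ℕ × ℕ, (coef p.1 a * coef p.2 b) • basisMul p.1 p.2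

instance : One CosSeq where
  one := e 0

lemma mul_def (a b : CosSeq) :
    a * b = ∑' p : ℕ × ℕ, (coef p.1 a * coef p.2 b) • basisMul p.1 p.2 :=
  rfl

lemma one_def : (1 : CosSeq) = e 0 := rfl

lemma norm_mul_le_mul_norm (a b : CosSeq) : ‖a * b‖ ≤ ‖a‖ * ‖b‖ := by
  have hs := summable_weight_mul_weight a b
  refine (tsum_of_norm_bounded hs.hasSum (norm_smul_basisMul_le a b)).trans_eq ?_
  rw [norm_eq, norm_eq,
    a.summable_weight_mul_abs_coef.tsum_mul_tsum b.summable_weight_mul_abs_coef hs]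

@[simp] lemma toFun_mul (a b : CosSeq) (ξ : ℝ) : toFun (a * b) ξ = toFun a ξ * toFun b ξ := by
  have hs : Summable fun p : ℕ × ℕ => (coef p.1 a * coef p.2 b) • basisMul p.1 p.2 :=
    (summable_weight_mul_weight a b).of_norm_bounded (norm_smul_basisMul_le a b)
  rw [← eval_apply, mul_def, (eval ξ).map_tsum hs, toFun, toFun,
    tsum_mul_tsum_of_summable_norm (a.summable_toFun ξ).norm (b.summable_toFun ξ).norm]
  refine tsum_congr fun p => ?_
  rw [map_smul, eval_apply, toFun_basisMul, smul_eq_mul]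
  ring

@[simp] lemma toFun_one (ξ : ℝ) : toFun 1 ξ = 1 := by
  rw [one_def, toFun_e, Nat.cast_zero, zero_mul, cos_zero]

instance : NormedCommRing CosSeq where
  __ := (inferInstance : NormedAddCommGroup CosSeq)
  left_distrib a b c := ext_toFun fun ξ => by simp only [toFun_add, toFun_mul, mul_add]
  right_distrib a b c := ext_toFun fun ξ => by simp only [toFun_add, toFun_mul, add_mul]
  zero_mul a := ext_toFun fun ξ => by rw [toFun_mul, toFun_zero, zero_mul]
  mul_zero a := ext_toFun fun ξ => by rw [toFun_mul, toFun_zero, mul_zero]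
  one_mul a := ext_toFun fun ξ => by rw [toFun_mul, toFun_one, one_mul]
  mul_one a := ext_toFun fun ξ => by rw [toFun_mul, toFun_one, mul_one]
  mul_assoc a b c := ext_toFun fun ξ => by simp only [toFun_mul, mul_assoc]
  mul_comm a b := ext_toFun fun ξ => by simp only [toFun_mul, mul_comm]
  norm_mul_le := norm_mul_le_mul_norm

@[simp] lemma toFun_pow (a : CosSeq) (m : ℕ) (ξ : ℝ) : toFun (a ^ m) ξ = toFun a ξ ^ m := by
  induction m with
  | zero => simp
  | succ m ih => rw [pow_succ, toFun_mul, ih, pow_succ]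

instance : Algebra ℝ CosSeq :=
  Algebra.ofModule (fun r a b => ext_toFun fun ξ => by simp [mul_assoc])
    fun r a b => ext_toFun fun ξ => by simp [mul_left_comm]

lemma norm_le_mul_norm_of_abs_coef_le {a b : CosSeq} {K : ℝ}
    (h : ∀ n, |coef n a| ≤ K * |coef n b|) : ‖a‖ ≤ K * ‖b‖ := by
  rw [norm_eq, norm_eq, ← tsum_mul_left]
  refine a.summable_weight_mul_abs_coef.tsum_le_tsum (fun n => ?_)
    (b.summable_weight_mul_abs_coef.mul_left K)
  rw [mul_left_comm]
  exact mul_le_mul_of_nonneg_left (h n) (weight_pos n).le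

/-- The operator that multiplies the `n`-th coefficient by `d n`. -/
def multiplier (d : ℕ → ℝ) (K : ℝ) (hd : ∀ n, |d n| ≤ K) : CosSeq →L[ℝ] CosSeq :=
  LinearMap.mkContinuous
    { toFun := fun a => ofCoef (fun n => d n * coef n a) <|
        (a.summable_weight_mul_abs_coef.mul_left K).of_nonneg_of_le (fun _ => by positivity)
          fun n => by
            rw [abs_mul, mul_left_comm]
            exact mul_le_mul_of_nonneg_right (hd n) (by positivity)
      map_add' := fun a b => ext_coef fun n => by simp [mul_add]
      map_smul' := fun t a => ext_coef fun n => by simp [mul_left_comm] } K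
    fun a => norm_le_mul_norm_of_abs_coef_le fun n => by
      simpa [abs_mul] using mul_le_mul_of_nonneg_right (hd n) (abs_nonneg _)

@[simp] lemma coef_multiplier (d : ℕ → ℝ) (K : ℝ) (hd) (a : CosSeq) (n : ℕ) :
    coef n (multiplier d K hd a) = d n * coef n a :=
  mul_div_cancel_left₀ (d n * coef n a) (weight_pos n).ne'

end CosSeq

/-! ### Cosine series and `H⁶` -/

/-- The bound `∑ (1 + n)⁶ |cₙ| ≤ K`, stated for finite partial sums so that it includes the
convergence of the series. -/
def H6Bound (a : CosSeq) (K : ℝ) : Prop :=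
  ∀ F : Finset ℕ, ∑ n ∈ F, (1 + n : ℝ) ^ 6 * |CosSeq.coef n a| ≤ K

namespace H6Bound

open CosSeq

variable {a b : CosSeq} {K L : ℝ}

lemma add (ha : H6Bound a K) (hb : H6Bound b L) : H6Bound (a + b) (K + L) := fun F => by
  refine (Finset.sum_le_sum fun n _ => ?_).trans
    (Finset.sum_add_distrib.trans_le (add_le_add (ha F) (hb F)))
  rw [← mul_add, map_add]
  gcongr
  exact abs_add_le _ _

lemma smul (ha : H6Bound a K) (t : ℝ) : H6Bound (t • a) (|t| * K) := fun F => by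
  simp only [map_smul, smul_eq_mul, abs_mul, mul_left_comm _ |t|, ← Finset.mul_sum]
  exact mul_le_mul_of_nonneg_left (ha F) (abs_nonneg t)

lemma e (n : ℕ) : H6Bound (e n) ((1 + n) ^ 6) := fun F => by
  simp only [coef_e, abs_ite, abs_one, abs_zero, mul_ite, mul_one, mul_zero, Finset.sum_ite_eq']
  split_ifs <;> [exact le_rfl; positivity]

lemma nonneg (h : H6Bound a K) : 0 ≤ K := by simpa using h ∅

lemma summable (h : H6Bound a K) : Summable fun n : ℕ => (1 + n : ℝ) ^ 6 * |coef n a| :=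
  summable_of_sum_le (fun _ => by positivity) h

lemma norm_iteratedFDeriv_coef_mul_cos_le (a : CosSeq) {j : ℕ} (hj : j ≤ 6) (n : ℕ) (x : ℝ) :
    ‖iteratedFDeriv ℝ j (fun ξ => coef n a * cos (n * ξ)) x‖ ≤ (1 + n) ^ 6 * |coef n a| := by
  have := congrFun (iteratedDeriv_cos_mul_add n 0 j) x
  simp only [add_zero] at this
  rw [norm_iteratedFDeriv_eq_norm_iteratedDeriv, iteratedDeriv_const_mul_field, this, norm_mul,
    norm_mul, mul_comm, Real.norm_eq_abs (coef n a)]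
  gcongr
  calc ‖(n : ℝ) ^ j‖ * ‖iteratedDeriv j cos (n * x)‖ ≤ (1 + n : ℝ) ^ j * 1 := by
        rw [norm_pow, Real.norm_natCast]
        gcongr
        · linarith
        · exact abs_iteratedDeriv_cos_le_one j _
    _ ≤ (1 + n) ^ 6 := by
        rw [mul_one]
        exact pow_le_pow_right₀ (by simp) hj

lemma contDiff (h : H6Bound a K) : ContDiff ℝ 6 (toFun a) :=
  contDiff_tsum (N := 6) (fun n => by fun_prop) (fun _ _ => h.summable) fun j n x hj =>
    norm_iteratedFDeriv_coef_mul_cos_le a (by exact_mod_cast hj) n x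

lemma abs_iteratedDeriv_le (h : H6Bound a K) {j : ℕ} (hj : j ≤ 6) (x : ℝ) :
    |iteratedDeriv j (toFun a) x| ≤ K := by
  rw [← Real.norm_eq_abs, ← norm_iteratedFDeriv_eq_norm_iteratedDeriv]
  unfold toFun
  rw [iteratedFDeriv_tsum_apply (N := 6) (fun n => by fun_prop) (fun _ _ => h.summable)
    (fun i n x hi => norm_iteratedFDeriv_coef_mul_cos_le a (by exact_mod_cast hi) n x)
    (by exact_mod_cast hj)]
  exact (tsum_of_norm_bounded h.summable.hasSum fun n =>
    norm_iteratedFDeriv_coef_mul_cos_le a hj n x).trans (h.summable.tsum_le_of_sum_le h)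

lemma memH6per (h : H6Bound a K) : MemH6per (toFun a) where
  continuous := a.continuous_toFun
  periodic := a.periodic_toFun
  weakDeriv j hj := by
    have hc : ContDiff ℝ j (toFun a) := h.contDiff.of_le (by exact_mod_cast hj)
    exact ⟨_, ⟨periodic_iteratedDeriv a.periodic_toFun j,
      memLp_periodMeasure_of_continuous (hc.continuous_iteratedDeriv' j)⟩,
      hasWeakDeriv_iteratedDeriv hc a.periodic_toFun⟩

lemma integral_sq_weakDeriv_le (h : H6Bound a K) {j : ℕ} (hj : j ≤ 6) :
    ∫ x in (0 : ℝ)..(2 * π), weakDeriv j (toFun a) x ^ 2 ≤ 2 * π * K ^ 2 := by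
  have hc : ContDiff ℝ j (toFun a) := h.contDiff.of_le (by exact_mod_cast hj)
  have classical : ∫ x in (0 : ℝ)..(2 * π), weakDeriv j (toFun a) x ^ 2 =
      ∫ x in (0 : ℝ)..(2 * π), iteratedDeriv j (toFun a) x ^ 2 := by
    apply intervalIntegral.integral_congr_ae_restrict
    rw [Set.uIoc_of_le two_pi_pos.le]
    filter_upwards [weakDeriv_ae_eq_iteratedDeriv hc a.periodic_toFun] with x hx
    rw [hx]
  calc ∫ x in (0 : ℝ)..(2 * π), weakDeriv j (toFun a) x ^ 2
      ≤ ∫ _ in (0 : ℝ)..(2 * π), K ^ 2 := by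
        rw [classical]
        refine intervalIntegral.integral_mono_on two_pi_pos.le
          (((hc.continuous_iteratedDeriv' j).pow 2).intervalIntegrable _ _)
          intervalIntegrable_const fun x _ => ?_
        exact sq_le_sq' (abs_le.1 (h.abs_iteratedDeriv_le hj x)).1
          (abs_le.1 (h.abs_iteratedDeriv_le hj x)).2
    _ = 2 * π * K ^ 2 := by simp

lemma h6norm_le (h : H6Bound a K) : h6norm (toFun a) ≤ √(14 * π) * K := by
  rw [h6norm, ← Real.sqrt_sq h.nonneg, ← Real.sqrt_mul (by positivity)]
  refine Real.sqrt_le_sqrt ((Finset.sum_le_card_nsmul _ _ (2 * π * K ^ 2) fun j hj =>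
    h.integral_sq_weakDeriv_le (Nat.lt_succ_iff.1 (Finset.mem_range.1 hj))).trans_eq ?_)
  rw [Finset.card_range, nsmul_eq_mul]
  push_cast
  ring

end H6Bound

lemma integral_sq_weakDeriv_le_h6norm_sq (u : ℝ → ℝ) {j : ℕ} (hj : j ≤ 6) :
    ∫ x in (0 : ℝ)..(2 * π), weakDeriv j u x ^ 2 ≤ h6norm u ^ 2 := by
  have nonneg (i : ℕ) (_ : i ∈ Finset.range 7) :
      0 ≤ ∫ x in (0 : ℝ)..(2 * π), weakDeriv i u x ^ 2 :=
    intervalIntegral.integral_nonneg two_pi_pos.le fun x _ => sq_nonneg _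
  rw [h6norm, Real.sq_sqrt (Finset.sum_nonneg nonneg)]
  exact Finset.single_le_sum nonneg (Finset.mem_range.2 (Nat.lt_succ_iff.2 hj))

lemma MemH6per.pow_six_mul_abs_cosCoeff_le {u : ℝ → ℝ} (hu : MemH6per u) (n : ℕ) :
    (n : ℝ) ^ 6 * |cosCoeff n u| ≤ h6norm u := by
  have norm_nonneg : 0 ≤ h6norm u := Real.sqrt_nonneg _
  rcases eq_or_ne n 0 with rfl | hn
  · simpa using norm_nonneg
  have hex := hu.weakDeriv 6 le_rfl
  have coeff_deriv : ∫ x in (0 : ℝ)..(2 * π), PatternCL.weakDeriv 6 u x * cos (n * x) =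
      -(π * (n ^ 6 * cosCoeff n u)) := by
    have := (hasWeakDeriv_weakDeriv hex).integral_mul_cos_add (i := 3) n 0
    simp only [add_zero] at this
    rw [this, integral_mul_cos_eq_cosCoeff]
    ring
  have integral_cos_sq : ∫ x in (0 : ℝ)..(2 * π), cos (n * x) ^ 2 = π := by
    simp_rw [sq, integral_cos_mul_cos, if_true, if_neg hn]
  have cauchy_schwarz := sq_integral_mul_le (memL2per_weakDeriv hex).2
    (memLp_periodMeasure_of_continuous (f := fun x => cos (n * x)) (by fun_prop))
  simp only [← intervalIntegral.integral_of_le two_pi_pos.le, coeff_deriv,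
    integral_cos_sq] at cauchy_schwarz
  have bound : (n ^ 6 * |cosCoeff n u|) ^ 2 * π ≤ h6norm u ^ 2 := by
    refine le_of_mul_le_mul_right (le_trans (le_of_eq ?_) (cauchy_schwarz.trans
      (mul_le_mul_of_nonneg_right (integral_sq_weakDeriv_le_h6norm_sq u le_rfl) pi_pos.le))) pi_pos
    rw [mul_pow _ |cosCoeff n u|, sq_abs]
    ring
  refine le_of_sq_le_sq ((le_mul_of_one_le_right (sq_nonneg _) ?_).trans bound) norm_nonneg
  linarith [pi_gt_three]

/-- The operator norm constant of the embedding of even mean-zero `H⁶` functions into `CosSeq`. -/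
def embeddingConst : ℝ := ∑' n : ℕ, 4 / (n : ℝ) ^ 4

lemma summable_four_div_pow : Summable fun n : ℕ => 4 / (n : ℝ) ^ 4 := by
  simpa only [div_eq_mul_inv] using (Real.summable_nat_pow_inv.2 (by norm_num)).mul_left 4

lemma MemH6per.exists_toFun_eq {u : ℝ → ℝ} (hu : MemH6per u) (he : ∀ ξ, u (-ξ) = u ξ)
    (hm : ∫ ξ in (0 : ℝ)..(2 * π), u ξ = 0) :
    ∃ a : CosSeq, a.toFun = u ∧ CosSeq.coef 0 a = 0 ∧ ‖a‖ ≤ embeddingConst * h6norm u := by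
  have coeff_zero : cosCoeff 0 u = 0 := by simp [cosCoeff, hm]
  have weighted_le (n : ℕ) : (1 + n) ^ 2 * |cosCoeff n u| ≤ 4 / (n : ℝ) ^ 4 * h6norm u := by
    rcases eq_or_ne n 0 with rfl | hn
    · simp [coeff_zero]
    have one_le : (1 : ℝ) ≤ n := by exact_mod_cast Nat.one_le_iff_ne_zero.2 hn
    rw [div_mul_eq_mul_div, le_div_iff₀ (by positivity)]
    calc (1 + n : ℝ) ^ 2 * |cosCoeff n u| * n ^ 4 ≤ (2 * n) ^ 2 * |cosCoeff n u| * n ^ 4 := by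
          gcongr; linarith
      _ = 4 * (n ^ 6 * |cosCoeff n u|) := by ring
      _ ≤ 4 * h6norm u := by gcongr; exact hu.pow_six_mul_abs_cosCoeff_le n
  have hs := summable_four_div_pow.mul_right (h6norm u)
  have summable := hs.of_nonneg_of_le (fun n => by positivity) weighted_le
  have coef_eq (n : ℕ) : CosSeq.coef n (.ofCoef (fun n => cosCoeff n u) summable) = cosCoeff n u :=
    CosSeq.coef_ofCoef _ summable n
  refine ⟨.ofCoef (fun n => cosCoeff n u) summable, ?_, (coef_eq 0).trans coeff_zero, ?_⟩
  · refine eq_of_ae_eq_of_periodic (CosSeq.continuous_toFun _) hu.continuous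
      (CosSeq.periodic_toFun _) hu.periodic (ae_eq_of_integral_mul_cos_add_eq
        (memLp_periodMeasure_of_continuous (CosSeq.continuous_toFun _)) hu.memL2per.2
        fun n θ => ?_)
    rw [integral_mul_cos_add_of_even (CosSeq.continuous_toFun _) (CosSeq.toFun_neg_arg _)
      (CosSeq.periodic_toFun _), integral_mul_cos_add_of_even hu.continuous he hu.periodic]
    rcases eq_or_ne n 0 with rfl | hn
    · simp [cosCoeff, CosSeq.integral_toFun, hm]
    · rw [CosSeq.cosCoeff_toFun _ hn, coef_eq]
  · rw [CosSeq.norm_eq, embeddingConst, ← tsum_mul_right]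
    simp only [coef_eq]
    exact summable.tsum_le_tsum weighted_le hs

/-! ### The noncritical modes -/

namespace CosSeq

lemma coef_one_e_mul (w : CosSeq) : coef 1 (e 1 * w) = coef 0 w + 1 / 2 * coef 2 w := by
  have h (x : ℝ) : toFun (e 1 * w) x * cos ((1 : ℕ) * x) =
      1 / 2 * (toFun w x * cos ((0 : ℕ) * x) + toFun w x * cos ((2 : ℕ) * x)) := by
    simp only [toFun_mul, toFun_e, Nat.cast_one, Nat.cast_zero, Nat.cast_ofNat, one_mul, zero_mul,
      cos_zero, cos_two_mul]
    ring
  have hw := w.continuous_toFun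
  rw [← cosCoeff_toFun _ one_ne_zero, cosCoeff]
  simp_rw [h]
  rw [intervalIntegral.integral_const_mul, intervalIntegral.integral_add
    (by apply Continuous.intervalIntegrable; fun_prop)
    (by apply Continuous.intervalIntegrable; fun_prop), integral_toFun_mul_cos,
    integral_toFun_mul_cos, if_pos rfl, if_neg two_ne_zero]
  field_simp

lemma coef_two_e_mul (w : CosSeq) : coef 2 (e 1 * w) = 1 / 2 * (coef 1 w + coef 3 w) := by
  have h (x : ℝ) : toFun (e 1 * w) x * cos ((2 : ℕ) * x) =
      1 / 2 * (toFun w x * cos ((1 : ℕ) * x) + toFun w x * cos ((3 : ℕ) * x)) := by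
    simp only [toFun_mul, toFun_e, Nat.cast_one, Nat.cast_ofNat, one_mul, cos_two_mul,
      cos_three_mul]
    ring
  have hw := w.continuous_toFun
  rw [← cosCoeff_toFun _ two_ne_zero, cosCoeff]
  simp_rw [h]
  rw [intervalIntegral.integral_const_mul, intervalIntegral.integral_add
    (by apply Continuous.intervalIntegrable; fun_prop)
    (by apply Continuous.intervalIntegrable; fun_prop), integral_toFun_mul_cos,
    integral_toFun_mul_cos, if_neg one_ne_zero, if_neg three_ne_zero]
  field_simp

lemma e_mul_e (m n : ℕ) : e m * e n = basisMul m n := ext_toFun fun ξ => by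
  rw [toFun_mul, toFun_basisMul, toFun_e, toFun_e]

lemma e_one_sq : e 1 ^ 2 = (1 / 2 : ℝ) • (e 0 + e 2) := by
  rw [sq, e_mul_e, basisMul, add_comm]
  simp

lemma e_two_sq : e 2 ^ 2 = (1 / 2 : ℝ) • (e 0 + e 4) := by
  rw [sq, e_mul_e, basisMul, add_comm]
  simp

lemma e_one_cube : e 1 ^ 3 = (3 / 4 : ℝ) • e 1 + (1 / 4 : ℝ) • e 3 := ext_toFun fun x => by
  simp only [toFun_pow, toFun_smul, toFun_add, toFun_e, Nat.cast_one, Nat.cast_ofNat, one_mul,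
    cos_three_mul]
  ring

lemma norm_e_one : ‖e 1‖ = 4 := by rw [norm_e]; norm_num

/-- The symbol `lam` is elliptic of order four on the modes `n ≥ 2`, uniformly: the constant `4` is
the one needed for `symbol k ε` with `k` near `1` and `ε` near `0`. The modes `0` and `1` are the
critical ones. -/
def IsElliptic (lam : ℕ → ℝ) : Prop := ∀ n : ℕ, 2 ≤ n → (n : ℝ) ^ 4 ≤ 4 * |lam n|

/-- The inverse of the symbol `lam` on the noncritical modes, and zero on the critical ones. -/
def invSymbol (lam : ℕ → ℝ) (n : ℕ) : ℝ := if n < 2 then 0 else (lam n)⁻¹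

variable {lam : ℕ → ℝ} {s A B : ℝ} {w z : CosSeq}

lemma IsElliptic.ne_zero (hl : IsElliptic lam) {n : ℕ} (hn : 2 ≤ n) : lam n ≠ 0 := by
  have : (0 : ℝ) < n := by positivity
  exact abs_pos.1 (by linarith [hl n hn, pow_pos this 4])

lemma IsElliptic.pow_four_mul_abs_invSymbol_le (hl : IsElliptic lam) (n : ℕ) :
    (n : ℝ) ^ 4 * |invSymbol lam n| ≤ 4 := by
  rcases lt_or_ge n 2 with hn | hn
  · simp [invSymbol, hn]
  · rw [invSymbol, if_neg hn.not_gt, abs_inv, ← div_eq_mul_inv,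
      div_le_iff₀ (abs_pos.2 (hl.ne_zero hn))]
    exact hl n hn

lemma IsElliptic.abs_invSymbol_le (hl : IsElliptic lam) (n : ℕ) : |invSymbol lam n| ≤ 1 / 4 := by
  rcases lt_or_ge n 2 with hn | hn
  · simp [invSymbol, hn]
  · have h2 : (2 : ℝ) ^ 4 ≤ n ^ 4 := by gcongr; exact_mod_cast hn
    nlinarith [hl.pow_four_mul_abs_invSymbol_le n, abs_nonneg (invSymbol lam n)]

/-- The inverse of the Fourier multiplier `lam` on the noncritical modes. -/
def noncriticalInv (hl : IsElliptic lam) : CosSeq →L[ℝ] CosSeq :=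
  multiplier (invSymbol lam) (1 / 4) hl.abs_invSymbol_le

lemma norm_noncriticalInv_le (hl : IsElliptic lam) (a : CosSeq) :
    ‖noncriticalInv hl a‖ ≤ 1 / 4 * ‖a‖ :=
  norm_le_mul_norm_of_abs_coef_le fun n => by
    rw [noncriticalInv, coef_multiplier, abs_mul]
    exact mul_le_mul_of_nonneg_right (hl.abs_invSymbol_le n) (abs_nonneg _)

lemma coef_noncriticalInv_of_lt (hl : IsElliptic lam) (a : CosSeq) {n : ℕ} (hn : n < 2) :
    coef n (noncriticalInv hl a) = 0 := by
  simp [noncriticalInv, invSymbol, hn]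

lemma coef_noncriticalInv (hl : IsElliptic lam) (a : CosSeq) {n : ℕ} (hn : 2 ≤ n) :
    coef n (noncriticalInv hl a) = (lam n)⁻¹ * coef n a := by
  simp [noncriticalInv, invSymbol, hn.not_gt]

lemma h6Bound_noncriticalInv (hl : IsElliptic lam) (a : CosSeq) :
    H6Bound (noncriticalInv hl a) (64 * ‖a‖) := fun F => by
  have hterm (n : ℕ) : (1 + n : ℝ) ^ 6 * |coef n (noncriticalInv hl a)| ≤
      64 * ((1 + n) ^ 2 * |coef n a|) := by
    rcases lt_or_ge n 2 with hn | hn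
    · rw [coef_noncriticalInv_of_lt hl a hn, abs_zero, mul_zero]; positivity
    · have hn1 : (1 : ℝ) ≤ n := by exact_mod_cast one_le_two.trans hn
      have hgain : (1 + n : ℝ) ^ 4 * |invSymbol lam n| ≤ 64 :=
        calc (1 + n : ℝ) ^ 4 * |invSymbol lam n| ≤ (2 * n) ^ 4 * |invSymbol lam n| := by
              gcongr; linarith
          _ = 16 * (n ^ 4 * |invSymbol lam n|) := by ring
          _ ≤ 64 := by linarith [hl.pow_four_mul_abs_invSymbol_le n]
      calc (1 + n : ℝ) ^ 6 * |coef n (noncriticalInv hl a)|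
          = (1 + n) ^ 4 * |invSymbol lam n| * ((1 + n) ^ 2 * |coef n a|) := by
            rw [noncriticalInv, coef_multiplier, abs_mul]; ring
        _ ≤ 64 * ((1 + n) ^ 2 * |coef n a|) := by gcongr
  calc ∑ n ∈ F, (1 + n : ℝ) ^ 6 * |coef n (noncriticalInv hl a)|
      ≤ ∑ n ∈ F, 64 * ((1 + n : ℝ) ^ 2 * |coef n a|) := Finset.sum_le_sum fun n _ => hterm n
    _ = 64 * ∑ n ∈ F, (1 + n : ℝ) ^ 2 * |coef n a| := by rw [Finset.mul_sum]
    _ ≤ 64 * ‖a‖ := by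
      rw [norm_eq]
      gcongr
      exact (summable_weight_mul_abs_coef a).sum_le_tsum _ fun n _ => by positivity

/-- The rescaled nonlinearity `s y² + A y³`, where `A` is the amplitude of the solution. -/
def nonlin (s A : ℝ) (y : CosSeq) : CosSeq := s • y ^ 2 + A • y ^ 3

/-- The radius of the ball in which the noncritical part is found: a bound of `nonlin s A` on the
ball of radius `5` for `|A| ≤ 1`. -/
def radius (s : ℝ) : ℝ := 25 * |s| + 125

lemma le_radius (s : ℝ) : 125 ≤ radius s := by rw [radius]; linarith [abs_nonneg s]

lemma norm_pow_le_of_le {y : CosSeq} {r : ℝ} (hy : ‖y‖ ≤ r) {n : ℕ} (hn : 0 < n) :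
    ‖y ^ n‖ ≤ r ^ n :=
  (norm_pow_le' y hn).trans (by gcongr)

lemma norm_smul_le_of_le {a : CosSeq} {t x y : ℝ} (ht : |t| ≤ x) (ha : ‖a‖ ≤ y) :
    ‖t • a‖ ≤ x * y := by
  rw [norm_smul, norm_eq_abs]
  exact mul_le_mul ht ha (norm_nonneg _) ((abs_nonneg _).trans ht)

lemma norm_cube_sub_cube_le {y z : CosSeq} (hy : ‖y‖ ≤ 5) (hz : ‖z‖ ≤ 5) :
    ‖y ^ 3 - z ^ 3‖ ≤ 75 * ‖y - z‖ :=
  calc ‖y ^ 3 - z ^ 3‖ = ‖(y ^ 2 + y * z + z ^ 2) * (y - z)‖ := by congr 1; ring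
    _ ≤ ‖y ^ 2 + y * z + z ^ 2‖ * ‖y - z‖ := norm_mul_le _ _
    _ ≤ 75 * ‖y - z‖ := by
      gcongr
      refine norm_add₃_le.trans ?_
      linarith [norm_pow_le_of_le hy two_pos, norm_mul_le_of_le hy hz, norm_pow_le_of_le hz two_pos]

lemma norm_nonlin_le {y : CosSeq} (hA : |A| ≤ 1) (hy : ‖y‖ ≤ 5) :
    ‖nonlin s A y‖ ≤ radius s := by
  have h2 := norm_smul_le_of_le (le_refl |s|) (norm_pow_le_of_le hy two_pos)
  have h3 := norm_smul_le_of_le hA (norm_pow_le_of_le hy three_pos)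
  rw [nonlin, radius]
  linarith [norm_add_le (s • y ^ 2) (A • y ^ 3)]

lemma norm_nonlin_sub_nonlin_le {y z : CosSeq} (hB : |B| ≤ 1) (hy : ‖y‖ ≤ 5) (hz : ‖z‖ ≤ 5) :
    ‖nonlin s A y - nonlin s B z‖ ≤ radius s * (‖y - z‖ + |A - B|) := by
  have h : nonlin s A y - nonlin s B z =
      s • ((y - z) * (y + z)) + (A - B) • y ^ 3 + B • (y ^ 3 - z ^ 3) := by
    simp only [nonlin, Algebra.smul_def, map_sub]
    ring
  have hadd : ‖y + z‖ ≤ 10 := (norm_add_le _ _).trans (by linarith)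
  have h1 := norm_smul_le_of_le (le_refl |s|) (norm_mul_le_of_le (le_refl ‖y - z‖) hadd)
  have h2 := norm_smul_le_of_le (le_refl |A - B|) (norm_pow_le_of_le hy three_pos)
  have h3 := norm_smul_le_of_le hB (norm_cube_sub_cube_le hy hz)
  rw [h, radius]
  refine norm_add₃_le.trans ?_
  nlinarith [norm_nonneg (y - z), mul_nonneg (abs_nonneg s) (norm_nonneg (y - z)),
    mul_nonneg (abs_nonneg s) (abs_nonneg (A - B))]

/-- The map whose fixed points `w` are the rescaled noncritical parts: `A cos ξ + A² w` then solves
the profile equation on all modes `n ≥ 2`. -/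
def step (s : ℝ) (hl : IsElliptic lam) (A : ℝ) (w : CosSeq) : CosSeq :=
  -noncriticalInv hl (nonlin s A (e 1 + A • w))

lemma norm_profile_le (hA : |A| * radius s ≤ 1) (hw : ‖w‖ ≤ radius s) : ‖e 1 + A • w‖ ≤ 5 := by
  have := norm_smul_le_of_le (le_refl |A|) hw
  linarith [norm_add_le (e 1) (A • w), norm_e_one]

lemma abs_le_one_of_mul_radius_le (hA : |A| * radius s ≤ 1) : |A| ≤ 1 := by
  nlinarith [le_radius s, abs_nonneg A]

lemma norm_step_le (hl : IsElliptic lam) (hA : |A| * radius s ≤ 1) (hw : ‖w‖ ≤ radius s) :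
    ‖step s hl A w‖ ≤ radius s := by
  rw [step, norm_neg]
  linarith [norm_noncriticalInv_le hl (nonlin s A (e 1 + A • w)), le_radius s,
    norm_nonlin_le (s := s) (abs_le_one_of_mul_radius_le hA) (norm_profile_le hA hw)]

lemma norm_profile_sub_profile_le (hw : ‖w‖ ≤ radius s) :
    ‖(e 1 + A • w) - (e 1 + B • z)‖ ≤ radius s * |A - B| + |B| * ‖w - z‖ := by
  have h1 := norm_smul_le_of_le (le_refl |A - B|) hw
  have h2 := norm_smul_le_of_le (le_refl |B|) (le_refl ‖w - z‖)
  rw [show (e 1 + A • w) - (e 1 + B • z) = (A - B) • w + B • (w - z) by module]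
  linarith [norm_add_le ((A - B) • w) (B • (w - z))]

lemma norm_step_sub_step_le (hl : IsElliptic lam) (hA : |A| * radius s ≤ 1)
    (hB : |B| * radius s ≤ 1) (hw : ‖w‖ ≤ radius s) (hz : ‖z‖ ≤ radius s) :
    ‖step s hl A w - step s hl B z‖ ≤ radius s ^ 2 * |A - B| + 1 / 2 * ‖w - z‖ := by
  have hR := le_radius s
  have hlin : ‖step s hl A w - step s hl B z‖ ≤
      1 / 4 * ‖nonlin s A (e 1 + A • w) - nonlin s B (e 1 + B • z)‖ := by
    rw [step, step, neg_sub_neg, ← map_sub, norm_sub_rev (nonlin s A _)]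
    exact norm_noncriticalInv_le hl _
  have hnonlin := norm_nonlin_sub_nonlin_le (s := s) (A := A) (abs_le_one_of_mul_radius_le hB)
    (norm_profile_le hA hw) (norm_profile_le hB hz)
  have hprofile : radius s * (‖(e 1 + A • w) - (e 1 + B • z)‖ + |A - B|) ≤
      radius s * (radius s * |A - B| + |B| * ‖w - z‖ + |A - B|) := by
    gcongr; exact norm_profile_sub_profile_le hw
  have hB' : |B| * radius s * ‖w - z‖ ≤ 1 * ‖w - z‖ := by gcongr
  have hR' : radius s * |A - B| ≤ radius s ^ 2 * |A - B| := by gcongr; nlinarith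
  nlinarith [norm_nonneg (w - z), abs_nonneg (A - B)]

/-- `w` is the rescaled noncritical part of a solution of amplitude `A`, up to the equation on the
critical mode `1`, which is the bifurcation equation for `A`. -/
structure IsCorrection (s : ℝ) (hl : IsElliptic lam) (A : ℝ) (w : CosSeq) : Prop where
  abs_mul_radius_le : |A| * radius s ≤ 1
  norm_le : ‖w‖ ≤ radius s
  step_eq : step s hl A w = w

lemma exists_isCorrection (hl : IsElliptic lam) (hA : |A| * radius s ≤ 1) :
    ∃ w, IsCorrection s hl A w := by
  have hmaps : Set.MapsTo (step s hl A) (Metric.closedBall 0 (radius s))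
      (Metric.closedBall 0 (radius s)) := fun w hw => by
    rw [mem_closedBall_zero_iff] at hw ⊢
    exact norm_step_le hl hA hw
  have hcontr : ContractingWith (1 / 2) (hmaps.restrict (step s hl A) _ _) := by
    refine ⟨by rw [← NNReal.coe_lt_coe]; norm_num, LipschitzWith.of_dist_le_mul fun x y => ?_⟩
    have := norm_step_sub_step_le hl hA hA (mem_closedBall_zero_iff.1 x.2)
      (mem_closedBall_zero_iff.1 y.2)
    rw [sub_self, abs_zero, mul_zero, zero_add] at this
    simpa [Subtype.dist_eq, dist_eq_norm] using this
  have hzero : (0 : CosSeq) ∈ Metric.closedBall 0 (radius s) :=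
    Metric.mem_closedBall_self (by linarith [le_radius s])
  obtain ⟨w, hw, hfix, -⟩ := hcontr.exists_fixedPoint' Metric.isClosed_closedBall.isComplete
    hmaps hzero (edist_ne_top _ _)
  exact ⟨w, hA, mem_closedBall_zero_iff.1 hw, hfix⟩

namespace IsCorrection

variable {hl : IsElliptic lam}

lemma norm_sub_le (hw : IsCorrection s hl A w) (hz : IsCorrection s hl B z) :
    ‖w - z‖ ≤ 2 * radius s ^ 2 * |A - B| := by
  have := norm_step_sub_step_le hl hw.abs_mul_radius_le hz.abs_mul_radius_le hw.norm_le hz.norm_le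
  rw [hw.step_eq, hz.step_eq] at this
  linarith

lemma norm_profile_le (hw : IsCorrection s hl A w) : ‖e 1 + A • w‖ ≤ 5 :=
  CosSeq.norm_profile_le hw.abs_mul_radius_le hw.norm_le

lemma coef_of_lt (hw : IsCorrection s hl A w) {n : ℕ} (hn : n < 2) : coef n w = 0 := by
  rw [← hw.step_eq, step, map_neg, coef_noncriticalInv_of_lt hl _ hn, neg_zero]

lemma mul_coef (hw : IsCorrection s hl A w) {n : ℕ} (hn : 2 ≤ n) :
    lam n * coef n w = -coef n (nonlin s A (e 1 + A • w)) := by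
  conv_lhs => rw [← hw.step_eq]
  rw [step, map_neg, coef_noncriticalInv hl _ hn, mul_neg, mul_inv_cancel_left₀ (hl.ne_zero hn)]

end IsCorrection

/-- The profile equation with symbol `lam` on the nonzero modes. -/
def Solves (s : ℝ) (lam : ℕ → ℝ) (a : CosSeq) : Prop :=
  ∀ n, n ≠ 0 → lam n * coef n a + coef n (nonlin s 1 a) = 0

/-- The cosine series `A cos ξ + A² w`. -/
def ansatz (A : ℝ) (w : CosSeq) : CosSeq := A • (e 1 + A • w)

lemma nonlin_ansatz (s A : ℝ) (w : CosSeq) :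
    nonlin s 1 (ansatz A w) = A ^ 2 • nonlin s A (e 1 + A • w) := by
  simp only [nonlin, ansatz, smul_pow]
  module

lemma IsCorrection.coef_zero_ansatz {hl : IsElliptic lam} (hw : IsCorrection s hl A w) :
    coef 0 (ansatz A w) = 0 := by
  simp [ansatz, coef_e, hw.coef_of_lt]

lemma IsCorrection.coef_one_ansatz {hl : IsElliptic lam} (hw : IsCorrection s hl A w) :
    coef 1 (ansatz A w) = A := by
  simp [ansatz, coef_e, hw.coef_of_lt]

lemma IsCorrection.solves_ansatz_iff {hl : IsElliptic lam} (hw : IsCorrection s hl A w) :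
    Solves s lam (ansatz A w) ↔ lam 1 * A + coef 1 (nonlin s 1 (ansatz A w)) = 0 := by
  refine ⟨fun h => ?_, fun h n hn => ?_⟩
  · simpa only [hw.coef_one_ansatz] using h 1 one_ne_zero
  · rcases eq_or_ne n 1 with rfl | hn1
    · rwa [hw.coef_one_ansatz]
    · have := hw.mul_coef (n := n) (by omega)
      rw [nonlin_ansatz]
      simp only [ansatz, map_smul, map_add, coef_e, if_neg hn1, smul_eq_mul]
      linear_combination A ^ 2 * this

section SmallSolutions

variable {a : CosSeq} (ha : ‖a‖ * radius s ≤ 1)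
include ha

lemma norm_nonlin_one_le_of_small : ‖nonlin s 1 a‖ ≤ (|s| + 1) * ‖a‖ ^ 2 := by
  have ha1 : ‖a‖ ≤ 1 := by nlinarith [norm_nonneg a, le_radius s]
  have h2 := norm_smul_le_of_le (le_refl |s|) (norm_pow_le' a two_pos)
  have h3 : ‖a ^ 3‖ ≤ ‖a‖ ^ 2 :=
    (norm_pow_le' a three_pos).trans (pow_le_pow_of_le_one (norm_nonneg a) ha1 (by norm_num))
  rw [nonlin, one_smul]
  linarith [norm_add_le (s • a ^ 2) (a ^ 3)]

variable {hl : IsElliptic lam} (hz : a - coef 1 a • e 1 = -noncriticalInv hl (nonlin s 1 a))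
include hz

lemma norm_noncritical_le_of_small :
    ‖a - coef 1 a • e 1‖ ≤ 1 / 4 * ((|s| + 1) * ‖a‖ ^ 2) := by
  rw [hz, norm_neg]
  exact (norm_noncriticalInv_le hl _).trans
    (mul_le_mul_of_nonneg_left (norm_nonlin_one_le_of_small ha) (by norm_num))

lemma norm_le_five_mul_abs_coef_one_of_small : ‖a‖ ≤ 5 * |coef 1 a| := by
  have htri : ‖a‖ ≤ 4 * |coef 1 a| + ‖a - coef 1 a • e 1‖ := by
    have := norm_add_le (coef 1 a • e 1) (a - coef 1 a • e 1)
    rwa [add_sub_cancel, norm_smul, norm_e_one, norm_eq_abs, mul_comm |_|] at this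
  have hsmall : 25 * (|s| + 1) * ‖a‖ ≤ 1 :=
    le_trans (by rw [radius]; nlinarith [norm_nonneg a]) ha
  nlinarith [norm_noncritical_le_of_small ha hz, norm_nonneg a]

lemma norm_noncritical_le_radius_mul_sq_of_small :
    ‖a - coef 1 a • e 1‖ ≤ radius s * coef 1 a ^ 2 := by
  have h25 : ‖a‖ ^ 2 ≤ 25 * coef 1 a ^ 2 :=
    calc ‖a‖ ^ 2 ≤ (5 * |coef 1 a|) ^ 2 := by
          gcongr; exact norm_le_five_mul_abs_coef_one_of_small ha hz
      _ = 25 * coef 1 a ^ 2 := by rw [mul_pow, sq_abs]; norm_num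
  calc ‖a - coef 1 a • e 1‖ ≤ 1 / 4 * ((|s| + 1) * ‖a‖ ^ 2) := norm_noncritical_le_of_small ha hz
    _ ≤ 1 / 4 * ((|s| + 1) * (25 * coef 1 a ^ 2)) := by gcongr
    _ ≤ radius s * coef 1 a ^ 2 := by
      rw [radius]
      nlinarith [mul_nonneg (abs_nonneg s) (sq_nonneg (coef 1 a)), sq_nonneg (coef 1 a)]

end SmallSolutions

lemma Solves.sub_smul_e_one_eq (hl : IsElliptic lam) {a : CosSeq} (hs : Solves s lam a)
    (h0 : coef 0 a = 0) : a - coef 1 a • e 1 = -noncriticalInv hl (nonlin s 1 a) :=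
  ext_coef fun n => by
    rw [map_sub, map_smul, map_neg, coef_e, smul_eq_mul]
    rcases lt_or_ge n 2 with hn | hn
    · rw [coef_noncriticalInv_of_lt hl _ hn]
      interval_cases n <;> simp [h0]
    · rw [coef_noncriticalInv hl _ hn, if_neg (by omega), eq_neg_of_add_eq_zero_right
        (hs n (by omega)), mul_neg, inv_mul_cancel_left₀ (hl.ne_zero hn)]
      ring

lemma Solves.exists_ansatz (hl : IsElliptic lam) {a : CosSeq} (hs : Solves s lam a)
    (ha : ‖a‖ * radius s ≤ 1) (h0 : coef 0 a = 0) :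
    ∃ A w, IsCorrection s hl A w ∧ a = ansatz A w := by
  have hz := hs.sub_smul_e_one_eq hl h0
  have hAR : |coef 1 a| * radius s ≤ 1 :=
    le_trans (mul_le_mul_of_nonneg_right (abs_coef_le 1 a) (by linarith [le_radius s])) ha
  rcases eq_or_ne (coef 1 a) 0 with hA | hA
  · obtain ⟨w, hw⟩ := exists_isCorrection hl hAR
    have ha0 : a = 0 := norm_le_zero_iff.1 <| by
      simpa [hA] using norm_le_five_mul_abs_coef_one_of_small ha hz
    exact ⟨_, w, hw, by rw [ansatz, hA, zero_smul, ha0]⟩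
  · set A := coef 1 a
    set w := (A ^ 2)⁻¹ • (a - A • e 1) with hw
    have hAw : A ^ 2 • w = a - A • e 1 := by rw [hw, smul_inv_smul₀ (pow_ne_zero 2 hA)]
    have haw : a = ansatz A w := by
      rw [ansatz, smul_add, smul_smul, ← sq, hAw, add_sub_cancel]
    refine ⟨A, w, ⟨hAR, ?_, ?_⟩, haw⟩
    · rw [hw, norm_smul, norm_of_nonneg (by positivity), inv_mul_le_iff₀ (by positivity), mul_comm]
      exact norm_noncritical_le_radius_mul_sq_of_small ha hz
    · refine smul_right_injective CosSeq (pow_ne_zero 2 hA) ?_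
      change A ^ 2 • step s hl A w = A ^ 2 • w
      rw [hAw, hz, step, smul_neg, ← map_smul, ← nonlin_ansatz, ← haw]

end CosSeq

/-! ### The bifurcation equation -/

namespace CosSeq

variable {lam : ℕ → ℝ} {s A B : ℝ} {w z : CosSeq}

/-- The part of `nonlin s A (e 1 + A • w)` beyond its value at `A = 0`, divided by `A`. -/
def higherOrder (s A : ℝ) (w : CosSeq) : CosSeq :=
  s • ((2 : ℝ) • (e 1 * w) + A • w ^ 2) + (e 1 + A • w) ^ 3

/-- The function `h` in the bifurcation equation `A² h = -lam 1` for the amplitude `A`. -/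
def bifurcation (s A : ℝ) (w : CosSeq) : ℝ := coef 1 (higherOrder s A w)

lemma nonlin_eq_add_higherOrder (s A : ℝ) (w : CosSeq) :
    nonlin s A (e 1 + A • w) = s • e 1 ^ 2 + A • higherOrder s A w := by
  simp only [nonlin, higherOrder, Algebra.smul_def, map_ofNat]
  ring

lemma coef_one_nonlin_ansatz (s A : ℝ) (w : CosSeq) :
    coef 1 (nonlin s 1 (ansatz A w)) = A ^ 3 * bifurcation s A w := by
  rw [nonlin_ansatz, nonlin_eq_add_higherOrder, e_one_sq]
  simp only [map_smul, map_add, coef_e, smul_eq_mul, bifurcation]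
  norm_num
  ring

lemma higherOrder_sub_higherOrder (s A B : ℝ) (w z : CosSeq) :
    higherOrder s A w - higherOrder s B z =
      s • ((2 : ℝ) • (e 1 * (w - z)) + (A - B) • w ^ 2 + B • ((w - z) * (w + z))) +
        ((e 1 + A • w) ^ 3 - (e 1 + B • z) ^ 3) := by
  simp only [higherOrder, Algebra.smul_def, map_ofNat, map_sub]
  ring

lemma abs_le_radius_div (s : ℝ) : |s| ≤ radius s / 25 := by rw [radius]; linarith

namespace IsCorrection

variable {hl : IsElliptic lam}

lemma norm_higherOrder_sub_le (hw : IsCorrection s hl A w) (hz : IsCorrection s hl B z) :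
    ‖higherOrder s A w - higherOrder s B z‖ ≤ 3 * radius s ^ 3 * |A - B| := by
  have hwz := hw.norm_sub_le hz
  have hR := le_radius s
  have hB1 := abs_le_one_of_mul_radius_le hz.abs_mul_radius_le
  set R := radius s
  set δ := ‖w - z‖
  set t := |A - B|
  have hδ : 0 ≤ δ := norm_nonneg _
  have _ht : 0 ≤ t := abs_nonneg _
  have hlinear : ‖(2 : ℝ) • (e 1 * (w - z))‖ ≤ 2 * (4 * δ) :=
    norm_smul_le_of_le abs_two.le (norm_mul_le_of_le norm_e_one.le le_rfl)
  have hcoeff : ‖(A - B) • w ^ 2‖ ≤ t * R ^ 2 :=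
    norm_smul_le_of_le le_rfl (norm_pow_le_of_le hw.norm_le two_pos)
  have hsquare : ‖B • ((w - z) * (w + z))‖ ≤ 2 * δ := by
    have hadd : ‖w + z‖ ≤ 2 * R := (norm_add_le _ _).trans (by linarith [hw.norm_le, hz.norm_le])
    calc ‖B • ((w - z) * (w + z))‖ ≤ |B| * (δ * (2 * R)) :=
          norm_smul_le_of_le le_rfl (norm_mul_le_of_le le_rfl hadd)
      _ = 2 * (|B| * R) * δ := by ring
      _ ≤ 2 * 1 * δ := by gcongr; exact hz.abs_mul_radius_le
      _ = 2 * δ := by ring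
  have hcube : ‖(e 1 + A • w) ^ 3 - (e 1 + B • z) ^ 3‖ ≤ 75 * (R * t + 1 * δ) :=
    (norm_cube_sub_cube_le hw.norm_profile_le hz.norm_profile_le).trans <| by
      gcongr
      exact (norm_profile_sub_profile_le hw.norm_le).trans (by gcongr)
  have hs : ‖s • ((2 : ℝ) • (e 1 * (w - z)) + (A - B) • w ^ 2 + B • ((w - z) * (w + z)))‖ ≤
      R / 25 * (2 * (4 * δ) + t * R ^ 2 + 2 * δ) :=
    norm_smul_le_of_le (abs_le_radius_div s) (norm_add₃_le.trans (by gcongr))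
  have hR2 : 125 * R ≤ R ^ 2 := by nlinarith
  rw [higherOrder_sub_higherOrder]
  calc _ ≤ R / 25 * (2 * (4 * δ) + t * R ^ 2 + 2 * δ) + 75 * (R * t + 1 * δ) :=
        (norm_add_le _ _).trans (by gcongr)
    _ ≤ R / 25 * (10 * (2 * R ^ 2 * t) + t * R ^ 2) + 75 * (R * t + 2 * R ^ 2 * t) := by
      nlinarith [mul_le_mul_of_nonneg_left hwz (by linarith : 0 ≤ R)]
    _ ≤ 3 * R ^ 3 * t := by nlinarith

lemma abs_bifurcation_sub_le (hw : IsCorrection s hl A w) (hz : IsCorrection s hl B z) :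
    |bifurcation s A w - bifurcation s B z| ≤ 3 * radius s ^ 3 * |A - B| := by
  rw [bifurcation, bifurcation, ← map_sub]
  exact (abs_coef_le 1 _).trans (hw.norm_higherOrder_sub_le hz)

lemma norm_higherOrder_le (hw : IsCorrection s hl A w) : ‖higherOrder s A w‖ ≤ radius s ^ 2 := by
  have hR := le_radius s
  have hcube := norm_pow_le_of_le hw.norm_profile_le three_pos
  have hlinear : ‖(2 : ℝ) • (e 1 * w)‖ ≤ 2 * (4 * radius s) :=
    norm_smul_le_of_le abs_two.le (norm_mul_le_of_le norm_e_one.le hw.norm_le)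
  have hsquare : ‖A • w ^ 2‖ ≤ 1 * radius s :=
    calc ‖A • w ^ 2‖ ≤ |A| * radius s ^ 2 :=
          norm_smul_le_of_le le_rfl (norm_pow_le_of_le hw.norm_le two_pos)
      _ = |A| * radius s * radius s := by ring
      _ ≤ 1 * radius s := by gcongr; exact hw.abs_mul_radius_le
  have hs : ‖s • ((2 : ℝ) • (e 1 * w) + A • w ^ 2)‖ ≤
      radius s / 25 * (2 * (4 * radius s) + 1 * radius s) :=
    norm_smul_le_of_le (abs_le_radius_div s) ((norm_add_le _ _).trans (by gcongr))
  rw [higherOrder]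
  refine (norm_add_le _ _).trans ?_
  nlinarith

lemma eq_smul_e_two_sub (hw : IsCorrection s hl A w) :
    w = (-(s / (2 * lam 2))) • e 2 - A • noncriticalInv hl (higherOrder s A w) := by
  have hexpand : w = -noncriticalInv hl (s • e 1 ^ 2 + A • higherOrder s A w) := by
    conv_lhs => rw [← hw.step_eq, step, nonlin_eq_add_higherOrder]
  have hquad : noncriticalInv hl (e 1 ^ 2) = (1 / (2 * lam 2)) • e 2 := ext_coef fun n => by
    rcases lt_or_ge n 2 with hn | hn
    · rw [coef_noncriticalInv_of_lt hl _ hn, map_smul, coef_e, if_neg hn.ne, smul_zero]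
    · rw [coef_noncriticalInv hl _ hn, e_one_sq]
      simp only [map_smul, map_add, coef_e, smul_eq_mul, if_neg (by omega : n ≠ 0), zero_add]
      split_ifs with h
      · subst h; ring
      · ring
  rw [map_add, map_smul, map_smul, hquad] at hexpand
  conv_lhs => rw [hexpand]
  module

lemma norm_noncriticalInv_higherOrder_le (hw : IsCorrection s hl A w) :
    ‖noncriticalInv hl (higherOrder s A w)‖ ≤ radius s ^ 2 / 4 :=
  (norm_noncriticalInv_le hl _).trans (by linarith [hw.norm_higherOrder_le])

lemma abs_coef_three_le (hw : IsCorrection s hl A w) : |coef 3 w| ≤ |A| * (radius s ^ 2 / 4) := by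
  have h : coef 3 w = -(A * coef 3 (noncriticalInv hl (higherOrder s A w))) := by
    conv_lhs => rw [hw.eq_smul_e_two_sub]
    simp [coef_e]
  rw [h, abs_neg, abs_mul]
  gcongr
  exact (abs_coef_le 3 _).trans hw.norm_noncriticalInv_higherOrder_le

lemma abs_coef_two_profile_cube_le (hw : IsCorrection s hl A w) :
    |coef 2 ((e 1 + A • w) ^ 3)| ≤ 75 * (|A| * radius s) := by
  have h : coef 2 ((e 1 + A • w) ^ 3) = coef 2 ((e 1 + A • w) ^ 3 - e 1 ^ 3) := by
    rw [map_sub, e_one_cube]; simp [coef_e]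
  rw [h]
  refine (abs_coef_le 2 _).trans ((norm_cube_sub_cube_le hw.norm_profile_le
    (by rw [norm_e_one]; norm_num)).trans ?_)
  rw [add_sub_cancel_left]
  gcongr
  exact norm_smul_le_of_le le_rfl hw.norm_le

/-- The even modes of `higherOrder` vanish at `A = 0`, where `w` is a multiple of `e 2`. -/
lemma abs_coef_two_higherOrder_le (hw : IsCorrection s hl A w) :
    |coef 2 (higherOrder s A w)| ≤ radius s ^ 3 * |A| := by
  have hR := le_radius s
  have hs := abs_le_radius_div s
  have hsquare : |coef 2 (w ^ 2)| ≤ radius s ^ 2 :=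
    (abs_coef_le 2 _).trans (norm_pow_le_of_le hw.norm_le two_pos)
  have hexpand : coef 2 (higherOrder s A w) =
      s * (coef 3 w + A * coef 2 (w ^ 2)) + coef 2 ((e 1 + A • w) ^ 3) := by
    simp only [higherOrder, map_add, map_smul, smul_eq_mul, coef_two_e_mul,
      hw.coef_of_lt one_lt_two]
    ring
  calc |coef 2 (higherOrder s A w)|
      ≤ |s| * (|coef 3 w| + |A| * |coef 2 (w ^ 2)|) + |coef 2 ((e 1 + A • w) ^ 3)| := by
        rw [hexpand, ← abs_mul A]
        refine (abs_add_le _ _).trans ?_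
        rw [abs_mul]
        gcongr
        exact abs_add_le _ _
    _ ≤ radius s / 25 * (|A| * (radius s ^ 2 / 4) + |A| * radius s ^ 2) +
          75 * (|A| * radius s) := by
      gcongr
      exacts [hw.abs_coef_three_le, hw.abs_coef_two_profile_cube_le]
    _ ≤ radius s ^ 3 * |A| := by
      have : 125 ^ 2 * radius s ≤ radius s ^ 3 := by
        nlinarith [mul_le_mul hR hR (by norm_num) (by linarith)]
      nlinarith [mul_le_mul_of_nonneg_right this (abs_nonneg A), abs_nonneg A]

lemma coef_two_eq (hw : IsCorrection s hl A w) :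
    coef 2 w = -(s / (2 * lam 2)) - A * coef 2 (noncriticalInv hl (higherOrder s A w)) := by
  conv_lhs => rw [hw.eq_smul_e_two_sub]
  simp [coef_e]

lemma abs_coef_one_sq_le (hw : IsCorrection s hl A w) :
    |coef 1 (w ^ 2)| ≤ radius s ^ 3 * |A| := by
  set b := -(s / (2 * lam 2))
  set r := noncriticalInv hl (higherOrder s A w)
  have hwb : w = b • e 2 - A • r := hw.eq_smul_e_two_sub
  have hsplit : w ^ 2 = b ^ 2 • e 2 ^ 2 - A • (r * ((2 : ℝ) • w + A • r)) := by
    rw [hwb]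
    simp only [Algebra.smul_def, map_pow, map_ofNat]
    ring
  have hcoef : coef 1 (w ^ 2) = -(A * coef 1 (r * ((2 : ℝ) • w + A • r))) := by
    rw [hsplit, e_two_sq]
    simp [coef_e]
  have hr := hw.norm_noncriticalInv_higherOrder_le
  have hAr : ‖A • r‖ ≤ radius s :=
    calc ‖A • r‖ ≤ |A| * (radius s ^ 2 / 4) := norm_smul_le_of_le le_rfl hr
      _ = |A| * radius s * (radius s / 4) := by ring
      _ ≤ radius s := by nlinarith [hw.abs_mul_radius_le, le_radius s]
  have hsum : ‖(2 : ℝ) • w + A • r‖ ≤ 3 * radius s :=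
    (norm_add_le _ _).trans (by linarith [norm_smul_le_of_le abs_two.le hw.norm_le])
  rw [hcoef, abs_neg, abs_mul, mul_comm]
  gcongr
  refine (abs_coef_le 1 _).trans ((norm_mul_le_of_le hr hsum).trans ?_)
  nlinarith [pow_pos (by linarith [le_radius s] : 0 < radius s) 3]

lemma abs_coef_one_e_sq_mul_le (hw : IsCorrection s hl A w) :
    |coef 1 (e 1 ^ 2 * w)| ≤ 4 * radius s ^ 2 * |A| := by
  set b := -(s / (2 * lam 2))
  set r := noncriticalInv hl (higherOrder s A w)
  have hwb : w = b • e 2 - A • r := hw.eq_smul_e_two_sub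
  have hcoef_e_two : coef 1 (e 1 ^ 2 * e 2) = 0 := by
    rw [e_one_sq, smul_mul_assoc, ← one_def, add_mul, one_mul, ← sq, e_two_sq]
    simp [coef_e]
  have hcoef : coef 1 (e 1 ^ 2 * w) = -(A * coef 1 (e 1 ^ 2 * r)) := by
    rw [hwb, mul_sub, mul_smul_comm, mul_smul_comm, map_sub, map_smul, map_smul, hcoef_e_two]
    simp
  rw [hcoef, abs_neg, abs_mul, mul_comm]
  gcongr
  refine (abs_coef_le 1 _).trans ((norm_mul_le_of_le (norm_pow_le_of_le norm_e_one.le two_pos)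
    hw.norm_noncriticalInv_higherOrder_le).trans ?_)
  linarith

lemma abs_coef_one_quadratic_le (hw : IsCorrection s hl A w) :
    |coef 1 ((3 * A ^ 2) • (e 1 * w ^ 2) + A ^ 3 • w ^ 3)| ≤ 13 * radius s ^ 2 * A ^ 2 := by
  have hquad : ‖(3 * A ^ 2) • (e 1 * w ^ 2)‖ ≤ 3 * A ^ 2 * (4 * radius s ^ 2) :=
    norm_smul_le_of_le (abs_of_nonneg (by positivity)).le
      (norm_mul_le_of_le norm_e_one.le (norm_pow_le_of_le hw.norm_le two_pos))
  have hcube : ‖A ^ 3 • w ^ 3‖ ≤ 1 * radius s ^ 2 * A ^ 2 :=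
    calc ‖A ^ 3 • w ^ 3‖ ≤ |A| ^ 3 * radius s ^ 3 :=
          norm_smul_le_of_le (abs_pow A 3).le (norm_pow_le_of_le hw.norm_le three_pos)
      _ = |A| * radius s * radius s ^ 2 * A ^ 2 := by rw [← sq_abs A]; ring
      _ ≤ 1 * radius s ^ 2 * A ^ 2 := by gcongr; exact hw.abs_mul_radius_le
  refine (abs_coef_le 1 _).trans ((norm_add_le _ _).trans ?_)
  linarith

lemma bifurcation_eq (hw : IsCorrection s hl A w) :
    bifurcation s A w = 3 / 4 - s ^ 2 / (2 * lam 2) +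
      (-(s * A * coef 2 (noncriticalInv hl (higherOrder s A w))) + s * A * coef 1 (w ^ 2) +
        3 * A * coef 1 (e 1 ^ 2 * w) +
        coef 1 ((3 * A ^ 2) • (e 1 * w ^ 2) + A ^ 3 • w ^ 3)) := by
  have hcube : (e 1 + A • w) ^ 3 = e 1 ^ 3 + (3 * A) • (e 1 ^ 2 * w) +
      ((3 * A ^ 2) • (e 1 * w ^ 2) + A ^ 3 • w ^ 3) := by
    simp only [Algebra.smul_def, map_mul, map_pow, map_ofNat]
    ring
  have hcoef : coef 1 (e 1 ^ 3) = 3 / 4 := by rw [e_one_cube]; simp [coef_e]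
  have hmode := hw.coef_two_eq
  generalize coef 2 (noncriticalInv hl (higherOrder s A w)) = r at hmode ⊢
  rw [bifurcation, higherOrder, hcube, map_add, map_add, map_add, hcoef]
  simp only [map_smul, map_add, smul_eq_mul, coef_one_e_mul, hw.coef_of_lt two_pos, hmode]
  ring

lemma abs_bifurcation_sub_leading_le (hw : IsCorrection s hl A w) :
    |bifurcation s A w - (3 / 4 - s ^ 2 / (2 * lam 2))| ≤ radius s ^ 4 * A ^ 2 := by
  have hR := le_radius s
  have hs := abs_le_radius_div s
  have hr : |coef 2 (noncriticalInv hl (higherOrder s A w))| ≤ radius s ^ 3 * |A| :=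
    calc _ = |invSymbol lam 2| * |coef 2 (higherOrder s A w)| := by
          rw [noncriticalInv, coef_multiplier, abs_mul]
      _ ≤ 1 * (radius s ^ 3 * |A|) := by
        gcongr
        exacts [(hl.abs_invSymbol_le 2).trans (by norm_num), hw.abs_coef_two_higherOrder_le]
      _ = radius s ^ 3 * |A| := one_mul _
  rw [hw.bifurcation_eq, add_sub_cancel_left]
  calc _ ≤ |s| * |A| * (radius s ^ 3 * |A|) + |s| * |A| * (radius s ^ 3 * |A|) +
        3 * |A| * (4 * radius s ^ 2 * |A|) + 13 * radius s ^ 2 * A ^ 2 := by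
        refine (abs_add_le _ _).trans (add_le_add ((abs_add_three _ _ _).trans
          (add_le_add_three ?_ ?_ ?_)) hw.abs_coef_one_quadratic_le)
        · rw [abs_neg, abs_mul, abs_mul]; gcongr
        · rw [abs_mul, abs_mul]; gcongr; exact hw.abs_coef_one_sq_le
        · rw [abs_mul, abs_mul, abs_of_pos (three_pos (α := ℝ))]
          gcongr
          exact hw.abs_coef_one_e_sq_mul_le
    _ = (2 * |s| * radius s ^ 3 + 25 * radius s ^ 2) * A ^ 2 := by rw [← sq_abs A]; ring
    _ ≤ radius s ^ 4 * A ^ 2 := by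
      gcongr
      have h2 : 125 ^ 2 ≤ radius s ^ 2 := by gcongr
      have h3 : 0 ≤ radius s ^ 3 := by positivity
      nlinarith [sq_nonneg (radius s)]

end IsCorrection

lemma exists_amplitude (hl : IsElliptic lam) {A₁ c μ : ℝ} (hA₁ : 0 ≤ A₁) (hR : A₁ * radius s ≤ 1)
    (hc : ∀ w, IsCorrection s hl A₁ w → c ≤ bifurcation s A₁ w) (hμ : μ ∈ Set.Icc 0 (A₁ ^ 2 * c)) :
    ∃ A ∈ Set.Icc 0 A₁, ∃ w, IsCorrection s hl A w ∧ A ^ 2 * bifurcation s A w = μ := by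
  have hAR (A : Set.Icc 0 A₁) : |(A : ℝ)| * radius s ≤ 1 := by
    rw [abs_of_nonneg A.2.1]
    exact le_trans (mul_le_mul_of_nonneg_right A.2.2 (by linarith [le_radius s])) hR
  choose w hw using fun A => exists_isCorrection hl (hAR A)
  have hcont : Continuous fun A : Set.Icc 0 A₁ => bifurcation s A (w A) :=
    (LipschitzWith.of_dist_le_mul (K := (3 * radius s ^ 3).toNNReal) fun A B => by
      have hR3 : 0 ≤ 3 * radius s ^ 3 := by have := le_radius s; positivity
      rw [coe_toNNReal _ hR3, Subtype.dist_eq, dist_eq, dist_eq]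
      exact (hw A).abs_bifurcation_sub_le (hw B)).continuous
  have : PreconnectedSpace (Set.Icc 0 A₁) := Subtype.preconnectedSpace isPreconnected_Icc
  obtain ⟨A, hA⟩ := mem_range_of_exists_le_of_exists_ge
    (((continuous_subtype_val.pow 2).mul hcont : Continuous fun A : Set.Icc 0 A₁ =>
      (A : ℝ) ^ 2 * bifurcation s A (w A)))
    ⟨⟨0, le_rfl, hA₁⟩, by simpa using hμ.1⟩
    ⟨⟨A₁, hA₁, le_rfl⟩, hμ.2.trans <|
      mul_le_mul_of_nonneg_left (hc _ (hw ⟨A₁, hA₁, le_rfl⟩)) (sq_nonneg _)⟩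
  exact ⟨A, A.2, w A, hw A, hA⟩

lemma IsCorrection.amplitude_unique {hl : IsElliptic lam} {A₁ c : ℝ} (hw : IsCorrection s hl A w)
    (hz : IsCorrection s hl B z) (hc : 3 * radius s ^ 3 * A₁ < c) (hA0 : 0 < A)
    (hB : B ∈ Set.Ioc 0 A₁) (hcA : c ≤ bifurcation s A w)
    (heq : A ^ 2 * bifurcation s A w = B ^ 2 * bifurcation s B z) : A = B := by
  have hR0 : 0 ≤ radius s := by linarith [le_radius s]
  have hA₁ : 0 ≤ A₁ := hB.1.le.trans hB.2
  have hc0 : 0 < c := lt_of_le_of_lt (by positivity) hc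
  have hdiff : (A - B) * ((A + B) * bifurcation s A w) =
      -(B ^ 2 * (bifurcation s A w - bifurcation s B z)) := by
    linear_combination heq
  have hle : |A - B| * ((A + B) * c) ≤ |A - B| * (B * (3 * radius s ^ 3 * A₁)) :=
    have hB0 := hB.1
    calc |A - B| * ((A + B) * c) ≤ |A - B| * ((A + B) * bifurcation s A w) := by gcongr
      _ = |(A - B) * ((A + B) * bifurcation s A w)| := by
        rw [abs_mul, abs_of_nonneg (mul_nonneg (by linarith) (hc0.le.trans hcA))]
      _ = B ^ 2 * |bifurcation s A w - bifurcation s B z| := by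
        rw [hdiff, abs_neg, abs_mul, abs_of_nonneg (sq_nonneg B)]
      _ ≤ B ^ 2 * (3 * radius s ^ 3 * |A - B|) := by
        gcongr; exact hw.abs_bifurcation_sub_le hz
      _ = |A - B| * (B * (3 * radius s ^ 3 * B)) := by ring
      _ ≤ |A - B| * (B * (3 * radius s ^ 3 * A₁)) := by gcongr; exact hB.2
  by_contra hne
  have hle' := le_of_mul_le_mul_left hle (abs_pos.2 (sub_ne_zero.2 hne))
  nlinarith [mul_lt_mul_of_pos_left hc hB.1, mul_pos hA0 hc0]

end CosSeq

/-! ### The dispersion relation near the critical wavenumber -/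

lemma pow_four_le_symbol {k ε : ℝ} (hk : |k ^ 2 - 1| ≤ 1 / 8) (hε : ε ^ 2 ≤ 1) {n : ℕ}
    (hn : 2 ≤ n) : (n : ℝ) ^ 4 ≤ 4 * symbol k ε n := by
  have hn2 : (2 : ℝ) ^ 2 ≤ (n : ℝ) ^ 2 := by gcongr; exact_mod_cast hn
  have hn4 : ((2 : ℝ) ^ 2) ^ 2 ≤ ((n : ℝ) ^ 2) ^ 2 := by gcongr
  have hk1 : 7 / 8 ≤ k ^ 2 := by linarith [(abs_le.1 hk).1]
  have hlin : 5 / 8 * (n : ℝ) ^ 2 ≤ k ^ 2 * n ^ 2 - 1 := by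
    have : 7 / 8 * (n : ℝ) ^ 2 ≤ k ^ 2 * n ^ 2 := by gcongr
    linarith
  have hsq : (5 / 8 * (n : ℝ) ^ 2) ^ 2 ≤ (k ^ 2 * n ^ 2 - 1) ^ 2 := by gcongr
  rw [symbol]
  nlinarith

lemma isElliptic_symbol {k ε : ℝ} (hk : |k ^ 2 - 1| ≤ 1 / 8) (hε : ε ^ 2 ≤ 1) :
    CosSeq.IsElliptic (symbol k ε) := fun n hn =>
  (pow_four_le_symbol hk hε hn).trans (by gcongr; exact le_abs_self _)

lemma symbol_one {k ε κ : ℝ} (hk : k ^ 2 = 1 + 2 * κ) :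
    symbol k ε 1 = -(ε ^ 2 - 4 * κ ^ 2) := by
  rw [symbol, hk, Nat.cast_one]; ring

lemma abs_inv_symbol_two_sub_le {k ε κ : ℝ} (hk : k ^ 2 = 1 + 2 * κ) (hε : ε ≤ 1 / 8)
    (hκ : |κ| ≤ ε / 2) : |(symbol k ε 2)⁻¹ - (1 / 9 - 16 / 27 * κ)| ≤ 8 * ε ^ 2 := by
  have hε0 : 0 ≤ ε := by linarith [abs_nonneg κ]
  have hκ1 := abs_le.1 (hκ.trans (by linarith : ε / 2 ≤ 1 / 16))
  have hκ2 : κ ^ 2 ≤ ε ^ 2 / 4 := by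
    rw [← sq_abs]; nlinarith [abs_nonneg κ]
  have hL4 : 4 ≤ symbol k ε 2 := by
    have := pow_four_le_symbol (by rw [hk, abs_le]; constructor <;> linarith)
      (by nlinarith : ε ^ 2 ≤ 1) (le_refl 2)
    norm_num at this
    linarith
  have hL : symbol k ε 2 = 9 + 48 * κ + 64 * κ ^ 2 - ε ^ 2 := by
    rw [symbol, hk]; push_cast; ring
  set L := symbol k ε 2
  have hnum : 1 - L * (1 / 9 - 16 / 27 * κ) =
      κ ^ 2 * (64 / 3) + κ * κ ^ 2 * (1024 / 27) + ε ^ 2 * (1 / 9) - κ * ε ^ 2 * (16 / 27) := by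
    rw [hL]; ring
  have hnum_le : |1 - L * (1 / 9 - 16 / 27 * κ)| ≤ 32 * ε ^ 2 := by
    rw [hnum, abs_le]
    constructor <;> nlinarith [sq_nonneg κ, sq_nonneg ε]
  have hL0 : 0 < L := by linarith
  rw [show L⁻¹ - (1 / 9 - 16 / 27 * κ) = (1 - L * (1 / 9 - 16 / 27 * κ)) / L by field_simp,
    abs_div, abs_of_pos hL0, div_le_iff₀ hL0]
  nlinarith [sq_nonneg ε]

lemma abs_inv_symbol_two_sub_ninth_le {k ε κ : ℝ} (hk : k ^ 2 = 1 + 2 * κ) (hε : ε ≤ 1 / 8)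
    (hκ : |κ| ≤ ε / 2) : |(symbol k ε 2)⁻¹ - 1 / 9| ≤ 9 * ε := by
  have h := abs_inv_symbol_two_sub_le hk hε hκ
  have hε0 : 0 ≤ ε := by linarith [abs_nonneg κ]
  rw [show (symbol k ε 2)⁻¹ - 1 / 9 =
    ((symbol k ε 2)⁻¹ - (1 / 9 - 16 / 27 * κ)) - 16 / 27 * κ by ring]
  refine (abs_sub _ _).trans ?_
  rw [abs_mul, abs_of_pos (by norm_num : (0 : ℝ) < 16 / 27)]
  nlinarith

/-! ### The bifurcating branch -/

namespace CosSeq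

/-- The number `27 - 2s²`, positive exactly when the bifurcation is supercritical. -/
def gap (s : ℝ) : ℝ := 27 - 2 * s ^ 2

/-- A range of amplitudes on which `bifurcation s A w` stays close to its value at `A = 0`. -/
def maxAmplitude (s : ℝ) : ℝ := gap s / (1000 * radius s ^ 3)

/-- A threshold for the `H⁶` norm below which the first coefficient of a profile is at most
`maxAmplitude s`. -/
def normBound (s : ℝ) : ℝ := maxAmplitude s / (embeddingConst + 1)

/-- A range of `ε` for which the branch fits into `maxAmplitude s` and `normBound s`. -/
def epsilonBound (s : ℝ) : ℝ :=
  min (maxAmplitude s * (gap s / 1000))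
    (normBound s / (√(14 * π) * (128 * √(72 / gap s)) + 1))

/-- The parameter regime of the bifurcation; `κ` stands for `ω ε`. -/
structure NearCritical (s ε κ k : ℝ) : Prop where
  gap_pos : 0 < gap s
  sq_eq : k ^ 2 = 1 + 2 * κ
  pos : 0 < ε
  lt : ε < epsilonBound s
  abs_detuning_le : |κ| ≤ ε / 2

lemma gap_le (s : ℝ) : gap s ≤ 27 := by rw [gap]; linarith [sq_nonneg s]

lemma embeddingConst_nonneg : 0 ≤ embeddingConst := tsum_nonneg fun _ => by positivity

section

variable {s : ℝ} (hs : 0 < gap s)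
include hs

lemma sq_le_of_gap_pos : s ^ 2 ≤ 27 / 2 := by rw [gap] at hs; linarith

lemma maxAmplitude_pos : 0 < maxAmplitude s := by
  have := le_radius s
  rw [maxAmplitude]; positivity

lemma normBound_pos : 0 < normBound s :=
  div_pos (maxAmplitude_pos hs) (by linarith [embeddingConst_nonneg])

lemma epsilonBound_pos : 0 < epsilonBound s := by
  have := maxAmplitude_pos hs
  have := normBound_pos hs
  rw [epsilonBound]; positivity

end

lemma maxAmplitude_mul_radius_pow (s : ℝ) : maxAmplitude s * radius s ^ 3 = gap s / 1000 := by
  have := le_radius s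
  rw [maxAmplitude]; field_simp

lemma maxAmplitude_mul_radius_lt (s : ℝ) : maxAmplitude s * radius s < 1 / 100 := by
  have hR := le_radius s
  refine lt_of_mul_lt_mul_right ?_ (sq_nonneg (radius s))
  have := maxAmplitude_mul_radius_pow s
  nlinarith [gap_le s]

lemma epsilonBound_le {s : ℝ} (hs : 0 < gap s) : epsilonBound s ≤ gap s / 100000 := by
  have hR := le_radius s
  have hA := maxAmplitude_mul_radius_lt s
  have : maxAmplitude s ≤ 1 / 100 := by nlinarith [maxAmplitude_pos hs]
  refine (min_le_left _ _).trans ?_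
  nlinarith

namespace NearCritical

variable {s ε κ k A B : ℝ} {w z : CosSeq} (h : NearCritical s ε κ k)
include h

lemma le_maxAmplitude_mul : ε ≤ maxAmplitude s * (gap s / 1000) := h.lt.le.trans (min_le_left _ _)

lemma mul_lt_normBound : √(14 * π) * (128 * (√(72 / gap s) * ε)) < normBound s := by
  have := (lt_div_iff₀ (by positivity)).1 (h.lt.trans_le (min_le_right _ _))
  linarith [h.pos]

lemma le_gap_div : ε ≤ gap s / 100000 := h.lt.le.trans (epsilonBound_le h.gap_pos)

lemma le_eighth : ε ≤ 1 / 8 := by linarith [h.le_gap_div, gap_le s]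

lemma k_ne_zero : k ≠ 0 := by
  rintro rfl
  have := (abs_le.1 h.abs_detuning_le).1
  linarith [h.sq_eq, h.le_eighth]

lemma isElliptic : IsElliptic (symbol k ε) := by
  have := abs_le.1 h.abs_detuning_le
  have := h.le_eighth
  refine isElliptic_symbol (by rw [h.sq_eq, abs_le]; constructor <;> linarith) ?_
  exact pow_le_one₀ h.pos.le (by linarith)

lemma detuning_nonneg : 0 ≤ ε ^ 2 - 4 * κ ^ 2 := by
  have : |κ| ^ 2 ≤ (ε / 2) ^ 2 := by gcongr; exact h.abs_detuning_le
  rw [sq_abs] at this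
  linarith

lemma le_bifurcation (hw : IsCorrection s h.isElliptic A w) (hA : |A| ≤ maxAmplitude s) :
    gap s / 72 ≤ bifurcation s A w := by
  have hlead := (abs_le.1 hw.abs_bifurcation_sub_leading_le).1
  have hinv := (abs_le.1 (abs_inv_symbol_two_sub_ninth_le h.sq_eq h.le_eighth h.abs_detuning_le)).2
  have hA2 : radius s ^ 4 * A ^ 2 ≤ gap s / 288 :=
    calc radius s ^ 4 * A ^ 2 ≤ radius s ^ 4 * maxAmplitude s ^ 2 := by
          rw [← sq_abs A]; gcongr
      _ = (maxAmplitude s * radius s ^ 3) * (maxAmplitude s * radius s) := by ring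
      _ ≤ gap s / 1000 * (1 / 100) := by
        rw [maxAmplitude_mul_radius_pow]
        have := h.gap_pos.le
        gcongr
        exact (maxAmplitude_mul_radius_lt s).le
      _ ≤ gap s / 288 := by linarith [h.gap_pos]
  have hs2 : s ^ 2 / 2 ≤ 27 / 4 := by linarith [sq_le_of_gap_pos h.gap_pos]
  have hsecond : s ^ 2 / 2 * ((symbol k ε 2)⁻¹ - 1 / 9) ≤ 27 / 4 * (9 * ε) :=
    calc _ ≤ s ^ 2 / 2 * (9 * ε) := by gcongr
      _ ≤ 27 / 4 * (9 * ε) := by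
        have := h.pos.le
        gcongr
  have hgap : 3 / 4 - s ^ 2 / (2 * symbol k ε 2) =
      gap s / 36 - s ^ 2 / 2 * ((symbol k ε 2)⁻¹ - 1 / 9) := by rw [gap]; ring
  linarith [h.le_gap_div, h.gap_pos]

end NearCritical

/-- `ansatz A w` is the point of the bifurcating branch at the parameters of `h`. -/
structure IsBranchPoint {s ε κ k : ℝ} (h : NearCritical s ε κ k) (A : ℝ) (w : CosSeq) : Prop
    extends IsCorrection s h.isElliptic A w where
  nonneg : 0 ≤ A
  le_maxAmplitude : A ≤ maxAmplitude s
  sq_mul_bifurcation : A ^ 2 * bifurcation s A w = ε ^ 2 - 4 * κ ^ 2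

lemma NearCritical.exists_isBranchPoint {s ε κ k : ℝ} (h : NearCritical s ε κ k) :
    ∃ A w, IsBranchPoint h A w := by
  have hmax := maxAmplitude_pos h.gap_pos
  have hμ : ε ^ 2 - 4 * κ ^ 2 ≤ maxAmplitude s ^ 2 * (gap s / 72) :=
    have hgap := h.gap_pos
    calc ε ^ 2 - 4 * κ ^ 2 ≤ ε ^ 2 := by linarith [sq_nonneg κ]
      _ ≤ (maxAmplitude s * (gap s / 1000)) ^ 2 := by
        gcongr
        exacts [h.pos.le, h.le_maxAmplitude_mul]
      _ = maxAmplitude s ^ 2 * (gap s / 1000 * (gap s / 1000)) := by ring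
      _ ≤ maxAmplitude s ^ 2 * (1 * (gap s / 72)) := by gcongr <;> linarith [gap_le s]
      _ = maxAmplitude s ^ 2 * (gap s / 72) := by rw [one_mul]
  obtain ⟨A, ⟨hA0, hA⟩, w, hw, heq⟩ := exists_amplitude h.isElliptic hmax.le
    (by linarith [maxAmplitude_mul_radius_lt s])
    (fun w hw => h.le_bifurcation hw (abs_of_pos hmax).le) ⟨h.detuning_nonneg, hμ⟩
  exact ⟨A, w, hw, hA0, hA, heq⟩

namespace IsBranchPoint

variable {s ε κ k A B : ℝ} {w z : CosSeq} {h : NearCritical s ε κ k}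

lemma le_bifurcation (hw : IsBranchPoint h A w) : gap s / 72 ≤ bifurcation s A w :=
  h.le_bifurcation hw.toIsCorrection ((abs_of_nonneg hw.nonneg).trans_le hw.le_maxAmplitude)

lemma abs_mul_radius_lt (hw : IsBranchPoint h A w) : |A| * radius s < 1 := by
  rw [abs_of_nonneg hw.nonneg]
  nlinarith [hw.le_maxAmplitude, maxAmplitude_mul_radius_lt s, le_radius s]

lemma bifurcation_pos (hw : IsBranchPoint h A w) : 0 < bifurcation s A w := by
  linarith [hw.le_bifurcation, h.gap_pos]

lemma amplitude_eq_zero_iff (hw : IsBranchPoint h A w) : A = 0 ↔ ε ^ 2 - 4 * κ ^ 2 = 0 := by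
  rw [← hw.sq_mul_bifurcation, mul_eq_zero, or_iff_left hw.bifurcation_pos.ne',
    pow_eq_zero_iff two_ne_zero]

lemma amplitude_eq (hw : IsBranchPoint h A w) (hz : IsBranchPoint h B z) : A = B := by
  rcases hw.nonneg.eq_or_lt with hA | hA
  · rw [← hA, eq_comm, hz.amplitude_eq_zero_iff, ← hw.amplitude_eq_zero_iff, ← hA]
  · have hB : 0 < B := hz.nonneg.lt_of_ne' fun hB =>
      hA.ne' (hw.amplitude_eq_zero_iff.2 (hz.amplitude_eq_zero_iff.1 hB))
    refine hw.toIsCorrection.amplitude_unique hz.toIsCorrection ?_ hA ⟨hB, hz.le_maxAmplitude⟩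
      hw.le_bifurcation (hw.sq_mul_bifurcation.trans hz.sq_mul_bifurcation.symm)
    linarith [maxAmplitude_mul_radius_pow s, h.gap_pos]

lemma unique (hw : IsBranchPoint h A w) (hz : IsBranchPoint h B z) : ansatz A w = ansatz B z := by
  obtain rfl := hw.amplitude_eq hz
  have hwz := hw.toIsCorrection.norm_sub_le hz.toIsCorrection
  rw [sub_self, abs_zero, mul_zero, norm_le_zero_iff, sub_eq_zero] at hwz
  rw [hwz]

end IsBranchPoint

lemma ansatz_zero (w : CosSeq) : ansatz 0 w = 0 := zero_smul ℝ _

lemma cosCoeff_nonlin (s : ℝ) (a : CosSeq) {n : ℕ} (hn : n ≠ 0) :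
    cosCoeff n (fun ξ => s * toFun a ξ ^ 2 + toFun a ξ ^ 3) = coef n (nonlin s 1 a) := by
  rw [← cosCoeff_toFun _ hn]
  congr 1
  ext ξ
  simp [nonlin]

lemma solves_of_isEvenProfile {ε k s : ℝ} (hk : k ≠ 0) {a : CosSeq}
    (h : IsEvenProfile ε k s (toFun a)) : Solves s (symbol k ε) a := by
  obtain ⟨hmem, heven, -, hsolves⟩ := h
  intro n hn
  have := (hmem.exists_solvesProfile_iff hk heven).1 hsolves n hn
  rwa [cosCoeff_toFun a hn, cosCoeff_nonlin s a hn] at this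

lemma isEvenProfile_of_solves {ε k s K : ℝ} (hk : k ≠ 0) {a : CosSeq} (ha : H6Bound a K)
    (h0 : coef 0 a = 0) (h : Solves s (symbol k ε) a) : IsEvenProfile ε k s (toFun a) := by
  refine ⟨ha.memH6per, a.toFun_neg_arg, by rw [integral_toFun, h0, zero_mul],
    (ha.memH6per.exists_solvesProfile_iff hk a.toFun_neg_arg).2 fun n hn => ?_⟩
  rw [cosCoeff_toFun a hn, cosCoeff_nonlin s a hn]
  exact h n hn

namespace IsCorrection

variable {lam : ℕ → ℝ} {hl : IsElliptic lam} {s A : ℝ} {w : CosSeq}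

lemma h6Bound_ansatz (hw : IsCorrection s hl A w) : H6Bound (ansatz A w) (128 * |A|) := by
  have hA1 := abs_le_one_of_mul_radius_le hw.abs_mul_radius_le
  have hnonlin := norm_nonlin_le (s := s) hA1 hw.norm_profile_le
  have hbound := ((H6Bound.e 1).add
    ((h6Bound_noncriticalInv hl (nonlin s A (e 1 + A • w))).smul A |>.smul (-1))).smul A
  have heq : ansatz A w =
      A • (e 1 + (-1 : ℝ) • A • noncriticalInv hl (nonlin s A (e 1 + A • w))) := by
    conv_lhs => rw [ansatz, ← hw.step_eq, step]
    module
  rw [heq]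
  refine fun F => (hbound F).trans ?_
  have : |A| * ‖nonlin s A (e 1 + A • w)‖ ≤ 1 :=
    (mul_le_mul_of_nonneg_left hnonlin (abs_nonneg A)).trans hw.abs_mul_radius_le
  rw [mul_comm 128]
  gcongr
  norm_num
  linarith

lemma exists_toFun_ansatz_zero_eq (hw : IsCorrection s hl A w) (hA : |A| * radius s < 1) :
    ∃ c > 0, toFun (ansatz A w) 0 = A * c := by
  refine ⟨1 + A * toFun w 0, ?_, by simp [ansatz]; ring⟩
  have : |A * toFun w 0| < 1 :=
    calc |A * toFun w 0| = |A| * |toFun w 0| := abs_mul _ _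
      _ ≤ |A| * radius s := by gcongr; exact (abs_toFun_le w 0).trans hw.norm_le
      _ < 1 := hA
  linarith [(abs_lt.1 this).1]

end IsCorrection

end CosSeq

/-! ### Asymptotics of the branch -/

lemma abs_sub_mul_le_of_sq_mul_eq {A M T h : ℝ} (hA : 0 ≤ A) (hM : 0 ≤ M) (hT : 0 < T)
    (hh : 0 < h) (heq : A ^ 2 * h = M ^ 2) : |A - M * T| ≤ M * |1 - h * T ^ 2| / (T * h) := by
  rcases hM.eq_or_lt with rfl | hM
  · have hA0 : A = 0 := by simpa [hh.ne'] using heq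
    simp [hA0]
  rw [le_div_iff₀ (by positivity)]
  refine le_of_mul_le_mul_left ?_ hM
  calc M * (|A - M * T| * (T * h)) = |A - M * T| * (M * T * h) := by ring
    _ ≤ |A - M * T| * ((A + M * T) * h) := by gcongr; linarith
    _ = |(A - M * T) * ((A + M * T) * h)| := by
      rw [abs_mul, abs_of_nonneg (by positivity : 0 ≤ (A + M * T) * h)]
    _ = |M ^ 2 * (1 - h * T ^ 2)| := by congr 1; linear_combination heq
    _ = M * (M * |1 - h * T ^ 2|) := by rw [abs_mul, abs_of_nonneg (sq_nonneg M)]; ring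

/-- The linear terms in `x` cancel. -/
lemma abs_one_sub_mul_slope_sq_le {D x h : ℝ} (hD : 0 < D) (hx : |x| ≤ 3 / 32) :
    |1 - h * ((6 - 32 * x) / √D) ^ 2| ≤
      114 * x ^ 2 + 81 / D * |h - D * (1 / 36 + 8 / 27 * x)| := by
  set ρ := h - D * (1 / 36 + 8 / 27 * x) with hρ
  have hx' := abs_le.1 hx
  have hsplit : 1 - h * ((6 - 32 * x) / √D) ^ 2 =
      x ^ 2 * (256 / 3 - 8192 / 27 * x) - (6 - 32 * x) ^ 2 / D * ρ := by
    rw [div_pow, sq_sqrt hD.le, hρ]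
    field_simp
    ring
  have hquad : |x ^ 2 * (256 / 3 - 8192 / 27 * x)| ≤ 114 * x ^ 2 := by
    rw [abs_mul, abs_of_nonneg (sq_nonneg x), mul_comm]
    gcongr
    rw [abs_le]
    constructor <;> linarith
  have hrest : |(6 - 32 * x) ^ 2 / D * ρ| ≤ 81 / D * |ρ| := by
    rw [abs_mul, abs_of_nonneg (by positivity)]
    gcongr
    nlinarith
  rw [hsplit]
  exact (abs_sub _ _).trans (add_le_add hquad hrest)

namespace CosSeq

/-- The factor `T` in the expansion `A = T √(ε² - 4κ²) + O(ε³)` of the amplitude. -/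
def leadingSlope (s κ : ℝ) : ℝ := (6 - 32 * (κ * (s ^ 2 / gap s))) / √(gap s)

/-- The cosine series of `expansion ε ω s`, with `κ = ω ε`. -/
def leadingProfile (s ε κ : ℝ) : CosSeq :=
  (√(ε ^ 2 - 4 * κ ^ 2) * leadingSlope s κ) • e 1 - (2 * s * (ε ^ 2 - 4 * κ ^ 2) / gap s) • e 2

/-- The constant in the error bound of order `ε²` for `bifurcation`. -/
def bifurcationConst (s : ℝ) : ℝ := 4 * s ^ 2 + 72 / gap s * radius s ^ 4

/-- The constant in the error bound of order `ε³` for the first cosine coefficient. -/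
def amplitudeConst (s : ℝ) : ℝ :=
  24 / √(gap s) * (114 * (s ^ 2 / gap s) ^ 2 + 81 / gap s * bifurcationConst s)

/-- The constant in the error bound of order `ε³` for the second cosine coefficient. -/
def secondHarmonicConst (s : ℝ) : ℝ :=
  36 * |s| * (4 * (bifurcationConst s + 2) + 9 * gap s) / gap s ^ 2

/-- The constant in the error bound of order `ε³` for the branch in the `H⁶` norm. -/
def expansionConst (s : ℝ) : ℝ :=
  √(14 * π) * (64 * amplitudeConst s + 729 * secondHarmonicConst s +
    64 * radius s ^ 2 * √(72 / gap s) ^ 3)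

lemma bifurcationConst_nonneg {s : ℝ} (hs : 0 < gap s) : 0 ≤ bifurcationConst s := by
  have := le_radius s
  rw [bifurcationConst]; positivity

lemma expansion_eq_toFun {s ε : ℝ} (hs : 0 < gap s) (hε : 0 ≤ ε) (ω ξ : ℝ) :
    expansion ε ω s ξ = toFun (leadingProfile s ε (ω * ε)) ξ := by
  have hM : √(ε ^ 2 - 4 * (ω * ε) ^ 2) = √(1 - 4 * ω ^ 2) * ε := by
    rw [show ε ^ 2 - 4 * (ω * ε) ^ 2 = (1 - 4 * ω ^ 2) * ε ^ 2 by ring,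
      sqrt_mul' _ (sq_nonneg ε), sqrt_sq hε]
  have hD : √(gap s ^ 3) = gap s * √(gap s) := by
    rw [show gap s ^ 3 = gap s ^ 2 * gap s by ring, sqrt_mul (sq_nonneg _), sqrt_sq hs.le]
  simp only [leadingProfile, leadingSlope, toFun_sub, toFun_smul, toFun_e, Nat.cast_one,
    Nat.cast_ofNat, one_mul, expansion]
  rw [← gap, sqrt_div' _ hs.le, sqrt_div' _ (pow_pos hs 3).le, hD, hM]
  field_simp
  ring

lemma NearCritical.abs_kappa_mul_le {s ε κ k : ℝ} (h : NearCritical s ε κ k) :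
    |κ * (s ^ 2 / gap s)| ≤ 3 / 32 := by
  have hgap := h.gap_pos
  rw [abs_mul, abs_of_nonneg (by positivity : 0 ≤ s ^ 2 / gap s), mul_div_assoc',
    div_le_iff₀ hgap]
  calc |κ| * s ^ 2 ≤ ε / 2 * (27 / 2) := by
        gcongr
        exacts [by linarith [h.pos], h.abs_detuning_le, sq_le_of_gap_pos hgap]
    _ ≤ 3 / 32 * gap s := by linarith [h.le_gap_div]

lemma NearCritical.three_div_sqrt_le_leadingSlope {s ε κ k : ℝ} (h : NearCritical s ε κ k) :
    3 / √(gap s) ≤ leadingSlope s κ := by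
  rw [leadingSlope]
  gcongr
  linarith [(abs_le.1 h.abs_kappa_mul_le).2]

namespace IsBranchPoint

variable {s ε κ k A : ℝ} {w : CosSeq} {h : NearCritical s ε κ k} (hw : IsBranchPoint h A w)
include hw

lemma sq_amplitude_le : A ^ 2 ≤ 72 / gap s * ε ^ 2 := by
  have hgap := h.gap_pos
  rw [div_mul_eq_mul_div, le_div_iff₀ hgap]
  nlinarith [mul_le_mul_of_nonneg_left hw.le_bifurcation (sq_nonneg A), hw.sq_mul_bifurcation,
    sq_nonneg κ]

lemma amplitude_le : A ≤ √(72 / gap s) * ε := by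
  rw [← sqrt_sq h.pos.le, ← sqrt_mul' _ (sq_nonneg ε)]
  exact le_sqrt_of_sq_le hw.sq_amplitude_le

lemma abs_bifurcation_sub_le :
    |bifurcation s A w - gap s * (1 / 36 + 8 / 27 * (κ * (s ^ 2 / gap s)))| ≤
      bifurcationConst s * ε ^ 2 := by
  have hlead := hw.abs_bifurcation_sub_leading_le
  have hinv := abs_inv_symbol_two_sub_le h.sq_eq h.le_eighth h.abs_detuning_le
  have hgap := h.gap_pos
  set L := symbol k ε 2
  have hsplit : bifurcation s A w - gap s * (1 / 36 + 8 / 27 * (κ * (s ^ 2 / gap s))) =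
      bifurcation s A w - (3 / 4 - s ^ 2 / (2 * L)) -
        s ^ 2 / 2 * (L⁻¹ - (1 / 9 - 16 / 27 * κ)) := by
    rw [show gap s * (1 / 36 + 8 / 27 * (κ * (s ^ 2 / gap s))) =
      gap s / 36 + 8 / 27 * κ * s ^ 2 by field_simp, gap]
    ring
  rw [hsplit, bifurcationConst]
  calc _ ≤ radius s ^ 4 * A ^ 2 + s ^ 2 / 2 * (8 * ε ^ 2) := by
        refine (abs_sub _ _).trans (add_le_add hlead ?_)
        rw [abs_mul, abs_of_nonneg (by positivity : 0 ≤ s ^ 2 / 2)]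
        gcongr
    _ ≤ radius s ^ 4 * (72 / gap s * ε ^ 2) + s ^ 2 / 2 * (8 * ε ^ 2) := by
        gcongr; exact hw.sq_amplitude_le
    _ = _ := by ring

lemma abs_bifurcation_sub_gap_div_le :
    |bifurcation s A w - gap s / 36| ≤ (bifurcationConst s + 2) * ε := by
  have hK := bifurcationConst_nonneg h.gap_pos
  have hε := h.pos.le
  have hsq : ε ^ 2 ≤ ε := by nlinarith [h.le_eighth]
  have hgap := h.gap_pos
  have hlinear : |8 / 27 * s ^ 2 * κ| ≤ 2 * ε := by
    rw [abs_mul, abs_of_nonneg (by positivity)]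
    calc 8 / 27 * s ^ 2 * |κ| ≤ 8 / 27 * (27 / 2) * (ε / 2) := by
          gcongr
          exacts [sq_le_of_gap_pos hgap, h.abs_detuning_le]
      _ = 2 * ε := by ring
  rw [show bifurcation s A w - gap s / 36 =
    bifurcation s A w - gap s * (1 / 36 + 8 / 27 * (κ * (s ^ 2 / gap s))) + 8 / 27 * s ^ 2 * κ by
      field_simp; ring]
  calc _ ≤ bifurcationConst s * ε ^ 2 + 2 * ε :=
        (abs_add_le _ _).trans (add_le_add hw.abs_bifurcation_sub_le hlinear)
    _ ≤ (bifurcationConst s + 2) * ε := by rw [add_mul]; gcongr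

lemma abs_one_sub_bifurcation_mul_le :
    |1 - bifurcation s A w * leadingSlope s κ ^ 2| ≤
      (114 * (s ^ 2 / gap s) ^ 2 + 81 / gap s * bifurcationConst s) * ε ^ 2 := by
  have hgap := h.gap_pos
  have hκ : κ ^ 2 ≤ ε ^ 2 := by linarith [h.detuning_nonneg, sq_nonneg κ]
  calc _ ≤ 114 * (κ * (s ^ 2 / gap s)) ^ 2 + 81 / gap s * (bifurcationConst s * ε ^ 2) :=
        (abs_one_sub_mul_slope_sq_le hgap h.abs_kappa_mul_le).trans <| by
          gcongr; exact hw.abs_bifurcation_sub_le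
    _ ≤ 114 * (ε ^ 2 * (s ^ 2 / gap s) ^ 2) + 81 / gap s * (bifurcationConst s * ε ^ 2) := by
      rw [mul_pow]; gcongr
    _ = _ := by ring

lemma abs_amplitude_sub_le :
    |A - √(ε ^ 2 - 4 * κ ^ 2) * leadingSlope s κ| ≤ amplitudeConst s * ε ^ 3 := by
  have hgap := h.gap_pos
  have hK := bifurcationConst_nonneg hgap
  have hT := h.three_div_sqrt_le_leadingSlope
  have hT0 : 0 < leadingSlope s κ := lt_of_lt_of_le (by positivity) hT
  have hM : √(ε ^ 2 - 4 * κ ^ 2) ≤ ε :=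
    (sqrt_le_sqrt (by linarith [sq_nonneg κ])).trans_eq (sqrt_sq h.pos.le)
  have hTh : √(gap s) / 24 ≤ leadingSlope s κ * bifurcation s A w :=
    calc √(gap s) / 24 = 3 / √(gap s) * (gap s / 72) := by
          field_simp; rw [sq_sqrt hgap.le]; ring
      _ ≤ leadingSlope s κ * bifurcation s A w := by gcongr; exact hw.le_bifurcation
  calc _ ≤ √(ε ^ 2 - 4 * κ ^ 2) * |1 - bifurcation s A w * leadingSlope s κ ^ 2| /
          (leadingSlope s κ * bifurcation s A w) :=
        abs_sub_mul_le_of_sq_mul_eq hw.nonneg (sqrt_nonneg _) hT0 hw.bifurcation_pos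
          (by rw [sq_sqrt h.detuning_nonneg, hw.sq_mul_bifurcation])
    _ ≤ ε * ((114 * (s ^ 2 / gap s) ^ 2 + 81 / gap s * bifurcationConst s) * ε ^ 2) /
          (√(gap s) / 24) := by
      have := h.pos.le
      gcongr
      exact hw.abs_one_sub_bifurcation_mul_le
    _ = amplitudeConst s * ε ^ 3 := by rw [amplitudeConst]; field_simp

lemma abs_secondHarmonic_sub_le :
    |A ^ 2 * -(s / (2 * symbol k ε 2)) + 2 * s * (ε ^ 2 - 4 * κ ^ 2) / gap s| ≤
      secondHarmonicConst s * ε ^ 3 := by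
  have hgap := h.gap_pos
  have hK := bifurcationConst_nonneg hgap
  have hh := hw.bifurcation_pos
  have hε := h.pos.le
  have hμ : ε ^ 2 - 4 * κ ^ 2 ≤ ε ^ 2 := by linarith [sq_nonneg κ]
  have hnum : |4 * (bifurcation s A w - gap s / 36) - gap s * ((symbol k ε 2)⁻¹ - 1 / 9)| ≤
      (4 * (bifurcationConst s + 2) + 9 * gap s) * ε := by
    refine (abs_sub _ _).trans ?_
    rw [abs_mul, abs_mul, abs_of_pos hgap, abs_of_pos (four_pos (α := ℝ))]
    nlinarith [hw.abs_bifurcation_sub_gap_div_le,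
      abs_inv_symbol_two_sub_ninth_le h.sq_eq h.le_eighth h.abs_detuning_le]
  have hden : gap s ^ 2 / 36 ≤ 2 * bifurcation s A w * gap s := by nlinarith [hw.le_bifurcation]
  have hsplit : A ^ 2 * -(s / (2 * symbol k ε 2)) + 2 * s * (ε ^ 2 - 4 * κ ^ 2) / gap s =
      s * (ε ^ 2 - 4 * κ ^ 2) *
        (4 * (bifurcation s A w - gap s / 36) - gap s * ((symbol k ε 2)⁻¹ - 1 / 9)) /
          (2 * bifurcation s A w * gap s) := by
    rw [← hw.sq_mul_bifurcation]
    field_simp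
    ring
  rw [hsplit, abs_div, abs_mul, abs_mul, abs_of_nonneg h.detuning_nonneg,
    abs_of_pos (by positivity : 0 < 2 * bifurcation s A w * gap s)]
  calc _ ≤ |s| * ε ^ 2 * ((4 * (bifurcationConst s + 2) + 9 * gap s) * ε) / (gap s ^ 2 / 36) := by
        gcongr
    _ = secondHarmonicConst s * ε ^ 3 := by rw [secondHarmonicConst]; field_simp

lemma h6Bound_sub_leadingProfile :
    H6Bound (ansatz A w - leadingProfile s ε κ)
      (|A - √(ε ^ 2 - 4 * κ ^ 2) * leadingSlope s κ| * (1 + (1 : ℕ)) ^ 6 +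
        |A ^ 2 * -(s / (2 * symbol k ε 2)) + 2 * s * (ε ^ 2 - 4 * κ ^ 2) / gap s| *
          (1 + (2 : ℕ)) ^ 6 +
        |-A ^ 3| * (64 * ‖higherOrder s A w‖)) := by
  have hsplit : ansatz A w - leadingProfile s ε κ =
      (A - √(ε ^ 2 - 4 * κ ^ 2) * leadingSlope s κ) • e 1 +
        (A ^ 2 * -(s / (2 * symbol k ε 2)) + 2 * s * (ε ^ 2 - 4 * κ ^ 2) / gap s) • e 2 +
        (-A ^ 3) • noncriticalInv h.isElliptic (higherOrder s A w) := by
    rw [ansatz, leadingProfile]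
    conv_lhs => rw [hw.eq_smul_e_two_sub]
    module
  rw [hsplit]
  exact (((H6Bound.e 1).smul _).add ((H6Bound.e 2).smul _)).add
    ((h6Bound_noncriticalInv h.isElliptic _).smul _)

lemma h6norm_sub_leadingProfile_le :
    h6norm (toFun (ansatz A w - leadingProfile s ε κ)) ≤ expansionConst s * ε ^ 3 := by
  have hcube : |-A ^ 3| ≤ √(72 / gap s) ^ 3 * ε ^ 3 := by
    rw [abs_neg, abs_pow, abs_of_nonneg hw.nonneg, ← mul_pow]
    gcongr
    exacts [hw.nonneg, hw.amplitude_le]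
  refine hw.h6Bound_sub_leadingProfile.h6norm_le.trans ?_
  rw [expansionConst, mul_assoc √(14 * π)]
  gcongr
  calc _ ≤ amplitudeConst s * ε ^ 3 * (1 + (1 : ℕ)) ^ 6 +
        secondHarmonicConst s * ε ^ 3 * (1 + (2 : ℕ)) ^ 6 +
        √(72 / gap s) ^ 3 * ε ^ 3 * (64 * radius s ^ 2) := by
        gcongr
        exacts [hw.abs_amplitude_sub_le, hw.abs_secondHarmonic_sub_le,
          (abs_nonneg _).trans hcube, hw.norm_higherOrder_le]
    _ = _ := by push_cast; ring

end IsBranchPoint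

end CosSeq

/-! ### Existence and uniqueness -/

namespace CosSeq

lemma NearCritical.of_abs_le {s ε ω : ℝ} (hs : 0 < gap s) (hε0 : 0 < ε) (hε : ε < epsilonBound s)
    (hω : |ω| ≤ 1 / 2) : NearCritical s ε (ω * ε) (√(1 + 2 * ω * ε)) where
  gap_pos := hs
  sq_eq := by
    have : ε ≤ 1 := by linarith [epsilonBound_le hs, gap_le s]
    rw [sq_sqrt (by nlinarith [(abs_le.1 hω).1]), mul_assoc]
  pos := hε0
  lt := hε
  abs_detuning_le := by rw [abs_mul, abs_of_pos hε0]; nlinarith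

lemma NearCritical.solves_ansatz_iff {s ε κ k A : ℝ} {w : CosSeq} (h : NearCritical s ε κ k)
    (hw : IsCorrection s h.isElliptic A w) :
    Solves s (symbol k ε) (ansatz A w) ↔
      A = 0 ∨ A ^ 2 * bifurcation s A w = ε ^ 2 - 4 * κ ^ 2 := by
  rw [hw.solves_ansatz_iff, symbol_one h.sq_eq, coef_one_nonlin_ansatz,
    ← sub_eq_zero (a := A ^ 2 * _), ← mul_eq_zero]
  ring_nf

namespace IsBranchPoint

variable {s ε κ k A : ℝ} {w : CosSeq} {h : NearCritical s ε κ k} (hw : IsBranchPoint h A w)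
include hw

lemma isEvenProfile : IsEvenProfile ε k s (toFun (ansatz A w)) :=
  isEvenProfile_of_solves h.k_ne_zero hw.h6Bound_ansatz hw.coef_zero_ansatz
    ((h.solves_ansatz_iff hw.toIsCorrection).2 (.inr hw.sq_mul_bifurcation))

lemma h6norm_lt : h6norm (toFun (ansatz A w)) < normBound s :=
  calc h6norm (toFun (ansatz A w)) ≤ √(14 * π) * (128 * |A|) := hw.h6Bound_ansatz.h6norm_le
    _ ≤ √(14 * π) * (128 * (√(72 / gap s) * ε)) := by
      rw [abs_of_nonneg hw.nonneg]; gcongr; exact hw.amplitude_le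
    _ < normBound s := h.mul_lt_normBound

lemma toFun_zero_pos (hμ : 0 < ε ^ 2 - 4 * κ ^ 2) : 0 < toFun (ansatz A w) 0 := by
  obtain ⟨c, hc, heq⟩ := hw.exists_toFun_ansatz_zero_eq hw.abs_mul_radius_lt
  rw [heq]
  exact mul_pos (hw.nonneg.lt_of_ne' (mt hw.amplitude_eq_zero_iff.1 hμ.ne')) hc

lemma toFun_eq_zero (hμ : ε ^ 2 - 4 * κ ^ 2 = 0) : toFun (ansatz A w) = 0 := by
  rw [hw.amplitude_eq_zero_iff.2 hμ, ansatz_zero]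
  exact funext toFun_zero

end IsBranchPoint

lemma norm_le_maxAmplitude_of_h6norm_lt {s : ℝ} {a : CosSeq}
    (ha : ‖a‖ ≤ embeddingConst * h6norm (toFun a)) (hδ : h6norm (toFun a) < normBound s) :
    ‖a‖ ≤ maxAmplitude s := by
  have hC := embeddingConst_nonneg
  have hnorm := (lt_div_iff₀ (by positivity)).1 hδ
  have : 0 ≤ h6norm (toFun a) := sqrt_nonneg _
  linarith

lemma NearCritical.exists_isBranchPoint_of_isEvenProfile {s ε κ k : ℝ} (h : NearCritical s ε κ k)
    {v : ℝ → ℝ} (hv : IsEvenProfile ε k s v) (hδ : h6norm v < normBound s)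
    (hpos : 0 < ε ^ 2 - 4 * κ ^ 2 → 0 < v 0) :
    ∃ B z, IsBranchPoint h B z ∧ v = toFun (ansatz B z) := by
  obtain ⟨a, rfl, h0, hnorm⟩ := hv.1.exists_toFun_eq hv.2.1 hv.2.2.1
  have hmax := norm_le_maxAmplitude_of_h6norm_lt hnorm hδ
  have hR : 0 ≤ radius s := by linarith [le_radius s]
  have hsmall : ‖a‖ * radius s < 1 := by
    linarith [mul_le_mul_of_nonneg_right hmax hR, maxAmplitude_mul_radius_lt s]
  have hsolves := solves_of_isEvenProfile h.k_ne_zero hv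
  obtain ⟨B, z, hz, rfl⟩ := hsolves.exists_ansatz h.isElliptic hsmall.le h0
  have hB : |B| ≤ ‖ansatz B z‖ := by
    simpa only [hz.coef_one_ansatz] using abs_coef_le 1 (ansatz B z)
  have hbif : 0 < bifurcation s B z := by
    linarith [h.le_bifurcation hz (hB.trans hmax), h.gap_pos]
  obtain ⟨c, hc, hval⟩ := hz.exists_toFun_ansatz_zero_eq
    ((mul_le_mul_of_nonneg_right hB hR).trans_lt hsmall)
  have hBpos (hμ : 0 < ε ^ 2 - 4 * κ ^ 2) : 0 < B :=
    (pos_iff_pos_of_mul_pos (hval ▸ hpos hμ)).2 hc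
  suffices 0 ≤ B ∧ B ^ 2 * bifurcation s B z = ε ^ 2 - 4 * κ ^ 2 from
    ⟨B, z, ⟨hz, this.1, (le_abs_self B).trans (hB.trans hmax), this.2⟩, rfl⟩
  rcases (h.solves_ansatz_iff hz).1 hsolves with rfl | heq
  · refine ⟨le_rfl, ?_⟩
    rw [zero_pow two_ne_zero, zero_mul]
    exact h.detuning_nonneg.eq_or_lt.resolve_right fun hμ => (hBpos hμ).false
  · rcases eq_or_ne B 0 with rfl | hB0
    · exact ⟨le_rfl, heq⟩
    · exact ⟨(hBpos (heq ▸ by positivity)).le, heq⟩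

lemma detuning_pos_iff {ε : ℝ} (hε : 0 < ε) (ω : ℝ) :
    0 < ε ^ 2 - 4 * (ω * ε) ^ 2 ↔ |ω| < 1 / 2 := by
  rw [show ε ^ 2 - 4 * (ω * ε) ^ 2 = 4 * ε ^ 2 * ((1 / 2) ^ 2 - ω ^ 2) by ring,
    mul_pos_iff_of_pos_left (by positivity), sub_pos, sq_lt_sq, abs_of_pos (one_half_pos (α := ℝ))]

lemma detuning_eq_zero {ω : ℝ} (hω : |ω| = 1 / 2) (ε : ℝ) : ε ^ 2 - 4 * (ω * ε) ^ 2 = 0 := by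
  rw [mul_pow, ← sq_abs ω, hω]; ring

lemma gap_pos_iff {s : ℝ} : 0 < gap s ↔ s ∈ Set.Ioo (-√(27 / 2)) √(27 / 2) := by
  rw [Set.mem_Ioo, ← abs_lt, ← sq_lt_sq₀ (abs_nonneg s) (sqrt_nonneg _), sq_abs,
    sq_sqrt (by norm_num), gap]
  constructor <;> intro h <;> linarith

end CosSeq

end PatternCL

end

open PatternCL PatternCL.CosSeq

theorem theorem1p1 (s : ℝ) (hs : s ∈ Set.Ioo (-√(27 / 2 : ℝ)) (√(27 / 2 : ℝ))) :
    ∃ ε₀ > (0 : ℝ), ∃ δ > (0 : ℝ), ∃ C : ℝ,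
      ∀ ε ∈ Set.Ioo 0 ε₀, ∀ ω ∈ Set.Icc (-(1 / 2) : ℝ) (1 / 2),
        ∃ u : ℝ → ℝ,
          -- a small even solution, positive at `0` (away from the end points `ω = ±1/2`)
          (PatternCL.IsEvenProfile ε (√(1 + 2 * ω * ε)) s u ∧ PatternCL.h6norm u < δ ∧
            (|ω| < 1 / 2 → 0 < u 0)) ∧
          -- the only one
          (∀ v : ℝ → ℝ, PatternCL.IsEvenProfile ε (√(1 + 2 * ω * ε)) s v →
            PatternCL.h6norm v < δ → (|ω| < 1 / 2 → 0 < v 0) → v = u) ∧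
          -- the zero solution at the end points
          (|ω| = 1 / 2 → u = 0) ∧
          -- the expansion, uniformly in `ω`
          PatternCL.h6norm (fun ξ => u ξ - PatternCL.expansion ε ω s ξ) ≤ C * ε ^ 3 := by
  have hgap : 0 < gap s := gap_pos_iff.2 hs
  refine ⟨epsilonBound s, epsilonBound_pos hgap, normBound s, normBound_pos hgap,
    expansionConst s, fun ε ⟨hε0, hε⟩ ω hω => ?_⟩
  have h := NearCritical.of_abs_le hgap hε0 hε (abs_le.2 hω)
  simp only [← detuning_pos_iff hε0]
  obtain ⟨A, w, hw⟩ := h.exists_isBranchPoint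
  refine ⟨toFun (ansatz A w), ⟨hw.isEvenProfile, hw.h6norm_lt, hw.toFun_zero_pos⟩, ?_,
    fun hω => hw.toFun_eq_zero (detuning_eq_zero hω ε), ?_⟩
  · intro v hv hδ hpos
    obtain ⟨B, z, hz, rfl⟩ := h.exists_isBranchPoint_of_isEvenProfile hv hδ hpos
    rw [hz.unique hw]
  · simp only [expansion_eq_toFun hgap hε0.le, ← toFun_sub]
    exact hw.h6norm_sub_leadingProfile_le
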